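/- **Notation.** For a $p\times p$ real matrix $M$ let $\|M\|_F$ be its Frobenius norm, $\|M\|$ its spectral norm and $\|M\|_*$ its nuclear norm (the sum of its singular values). If $A=\sum_{i=1}^p a_iu_iv_i^{\top}$ is a singular value decomposition with $a_1\ge a_2\ge\cdots\ge a_p\ge 0$, put $A_{-\max(r)}=\sum_{i\ge r+1}a_iu_iv_i^{\top}$. Let $\mathbb S^p$ be the set of real symmetric $p\times p$ matrices. **Model and estimator.** Let $\beta^{(1)},\dots,\beta^{(n)}$ be random vectors in $\mathbb R^p$ with i.i.d. $N(0,1)$ entries and let $z_1,\dots,z_n$ be i.i.d. $N(0,\sigma^2)$, $\sigma\ge 0$, independent of the $\beta^{(i)}$. Define $[\mathcal X(M)]_i=(\beta^{(i)})^{\top}M\beta^{(i)}$ for $i=1,\dots,n$ and, for $A\in\mathbb S^p$, observe $y=\mathcal X(A)+z$. Let $$[\tilde{\mathcal X}(M)]_i=[\mathcal X(M)]_{2i-1}-[\mathcal X(M)]_{2i},\qquad \tilde y_i=y_{2i-1}-y_{2i},\qquad i=1,\dots,\lfloor n/2\rfloor,$$ $$\tilde{\mathcal X}^*(w)=\sum_{i=1}^{\lfloor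 n/2\rfloor}w_i\bigl(\beta^{(2i-1)}\beta^{(2i-1)\top}-\beta^{(2i)}\beta^{(2i)\top}\bigr),\qquad \eta=24\sigma\bigl(\sqrt{pn}+2p\sqrt{2\log n}\bigr),$$ and let the estimator $\hat A$ be a solution of $$\hat A\in\mathop{\arg\min}_{M\in\mathbb S^p}\Bigl\{\|M\|_*:\ \|y-\mathcal X(M)\|_1/n\le\sigma,\ \ \bigl\|\tilde{\mathcal X}^*\bigl(\tilde y-\tilde{\mathcal X}(M)\bigr)\bigr\|\le\eta\Bigr\}.$$ **Proposition.** There are universal constants $C,W_1,W_2,\delta>0$ such that for all integers $n,p,r\ge1$ with $n\ge Crp$ and all $\sigma\ge 0$, there is an event, not depending on $A$, of probability at least $1-15/n-5e^{-p\delta}$ on which, simultaneously for all $A\in\mathbb S^p$, a minimizer $\hat A$ exists and every minimizer satisfies $$\|\hat A-A\|_F^2\le W_1\sigma^2\min\Bigl(\frac{rp^2\log n}{n^2}+\frac{rp}{n},\,1\Bigr)+W_2\frac{\|A_{-\max(r)}\|_*^2}{r}.$$ -/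

import Mathlib

open MeasureTheory ProbabilityTheory
open scoped Matrix NNReal

namespace SROP

noncomputable section

/-- The Frobenius norm. -/
def frobeniusNorm {p : ℕ} (M : Matrix (Fin p) (Fin p) ℝ) : ℝ :=
  √(∑ i, ∑ j, M i j ^ 2)

/-- The spectral norm: the operator norm for the Euclidean norm on `ℝ^p`. -/
def specNorm {p : ℕ} (M : Matrix (Fin p) (Fin p) ℝ) : ℝ :=
  ‖Matrix.toEuclideanCLM (n := Fin p) (𝕜 := ℝ) M‖

/-- The nuclear norm: the sum of the singular values. -/
def nuclearNorm {p : ℕ} (M : Matrix (Fin p) (Fin p) ℝ) : ℝ :=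
  ∑ i ∈ Finset.range p, (Matrix.toEuclideanLin M).singularValues i

/-- `A = ∑ i, a i • u i (v i)ᵀ` is a singular value decomposition, with the singular values
in nonincreasing order. -/
structure IsSVD {p : ℕ} (A : Matrix (Fin p) (Fin p) ℝ) (a : Fin p → ℝ)
    (u v : Fin p → EuclideanSpace ℝ (Fin p)) : Prop where
  antitone : Antitone a
  nonneg : ∀ i, 0 ≤ a i
  orthonormal_left : Orthonormal ℝ u
  orthonormal_right : Orthonormal ℝ v
  eq_sum : A = ∑ i, a i • Matrix.vecMulVec (u i) (v i)

/-- Every symmetric matrix has a singular value decomposition. -/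
theorem exists_isSVD {p : ℕ} (A : Matrix (Fin p) (Fin p) ℝ) (hA : A.IsSymm) :
    ∃ a u v, IsSVD A a u v := by
  have hH : A.IsHermitian := by
    rw [Matrix.IsHermitian, Matrix.conjTranspose_eq_transpose_of_trivial]
    exact hA
  let w := hH.eigenvectorBasis
  let l := hH.eigenvalues
  let s : Equiv.Perm (Fin p) := Tuple.sort fun i => -|l i|
  have hs : Monotone ((fun i => -|l i|) ∘ s) := Tuple.monotone_sort _
  have hw : Orthonormal ℝ (w ∘ s) := w.orthonormal.comp _ s.injective
  refine ⟨fun i => |l (s i)|, fun i => (if 0 ≤ l (s i) then (1 : ℝ) else -1) • w (s i), w ∘ s,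
    ?_, fun i => abs_nonneg _, ?_, hw, ?_⟩
  · intro i j hij
    have := hs hij
    simpa using this
  · refine ⟨fun i => ?_, fun i j hij => ?_⟩
    · rw [norm_smul, w.orthonormal.1]
      split_ifs <;> simp
    · have h0 := w.orthonormal.2 (s.injective.ne hij)
      simp only [inner_smul_left, inner_smul_right, h0, mul_zero]
  · have h1 : A = ∑ i, l i • Matrix.vecMulVec (w i) (w i) := by
      apply Matrix.ext_of_mulVec_single
      intro j
      have hrep := w.sum_repr (EuclideanSpace.single j (1 : ℝ))
      have hj : (Pi.single j (1 : ℝ) : Fin p → ℝ)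
          = ∑ i, w i j • (w i : Fin p → ℝ) := by
        have h2 := congrArg (fun x : EuclideanSpace ℝ (Fin p) => (x : Fin p → ℝ)) hrep
        ext k
        have h3 := congrFun h2 k
        simp [w.repr_apply_apply, EuclideanSpace.inner_single_right] at h3
        simp [h3, Pi.single_apply]
      rw [Matrix.sum_mulVec]
      conv_lhs => rw [hj, Matrix.mulVec_sum]
      refine Finset.sum_congr rfl fun i _ => ?_
      rw [Matrix.mulVec_smul, hH.mulVec_eigenvectorBasis i, Matrix.smul_mulVec,
        Matrix.vecMulVec_mulVec]
      ext k
      simp [w, l]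
      ring
    rw [h1, ← Equiv.sum_comp s]
    refine Finset.sum_congr rfl fun i _ => ?_
    ext j k
    simp only [Matrix.smul_apply, Matrix.vecMulVec_apply, smul_eq_mul, Function.comp]
    change l (s i) * _ = |l (s i)| * _
    split_ifs with h
    · simp [abs_of_nonneg h]
    · simp [abs_of_neg (not_le.mp h)]

/-- The tail `∑_{i ≥ r + 1} a_i u_i v_iᵀ` (one-based indices) of a singular value decomposition:
what is left of the matrix when its `r` largest singular components are removed. -/
def svdTail {p : ℕ} (r : ℕ) (a : Fin p → ℝ) (u v : Fin p → EuclideanSpace ℝ (Fin p)) :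
    Matrix (Fin p) (Fin p) ℝ :=
  ∑ i ∈ Finset.univ.filter (fun i : Fin p => r ≤ (i : ℕ)), a i • Matrix.vecMulVec (u i) (v i)

/-- The map `[𝒳(M)]_i = (β⁽ⁱ⁾)ᵀ M β⁽ⁱ⁾`. -/
def design {n p : ℕ} (β : Fin n → Fin p → ℝ) (M : Matrix (Fin p) (Fin p) ℝ) : Fin n → ℝ :=
  fun i => β i ⬝ᵥ (M *ᵥ β i)

/-- Zero-based position of the first member of the `i`-th consecutive pair. -/
def fstIdx {n : ℕ} (i : Fin (n / 2)) : Fin n := ⟨2 * i, by omega⟩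

/-- Zero-based position of the second member of the `i`-th consecutive pair. -/
def sndIdx {n : ℕ} (i : Fin (n / 2)) : Fin n := ⟨2 * i + 1, by omega⟩

/-- The differences over consecutive pairs, `w ↦ w̃`. -/
def pairDiff {n : ℕ} (w : Fin n → ℝ) : Fin (n / 2) → ℝ :=
  fun i => w (fstIdx i) - w (sndIdx i)

/-- The pairwise-differenced map `𝒳̃`. -/
def diffDesign {n p : ℕ} (β : Fin n → Fin p → ℝ) (M : Matrix (Fin p) (Fin p) ℝ) :
    Fin (n / 2) → ℝ :=
  pairDiff (design β M)

/-- The dual map `𝒳̃*`. -/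
def diffDual {n p : ℕ} (β : Fin n → Fin p → ℝ) (w : Fin (n / 2) → ℝ) :
    Matrix (Fin p) (Fin p) ℝ :=
  ∑ i, w i • (Matrix.vecMulVec (β (fstIdx i)) (β (fstIdx i)) -
    Matrix.vecMulVec (β (sndIdx i)) (β (sndIdx i)))

/-- The tuning parameter `η`. -/
def tuning (n p : ℕ) (σ : ℝ) : ℝ :=
  24 * σ * (√((p : ℝ) * n) + 2 * p * √(2 * Real.log n))

/-- The constraint set of the estimator: symmetric matrices satisfying the `ℓ₁` constraint and
the Dantzig constraint on the pairwise differences. -/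
def feasible {n p : ℕ} (σ : ℝ) (β : Fin n → Fin p → ℝ) (y : Fin n → ℝ) :
    Set (Matrix (Fin p) (Fin p) ℝ) :=
  {M | M.IsSymm ∧ (∑ i, |y i - design β M i|) / n ≤ σ ∧
    specNorm (diffDual β (pairDiff y - diffDesign β M)) ≤ tuning n p σ}

/-- `Â` is a minimizer of the nuclear norm over the constraint set. -/
def IsEstimator {n p : ℕ} (σ : ℝ) (β : Fin n → Fin p → ℝ) (y : Fin n → ℝ)
    (Ahat : Matrix (Fin p) (Fin p) ℝ) : Prop :=
  Ahat ∈ feasible σ β y ∧ IsMinOn nuclearNorm (feasible σ β y) Ahat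

end

end SROP

namespace SROP

open scoped RealInnerProductSpace ENNReal

/-! Everything reduces to one event on which three things hold: the mean absolute noise is at most
`σ`, the dual noise `𝒳̃*(z̃)` has spectral norm at most `η`, and the differenced design satisfies
`(m/4)‖D‖_F ≤ ‖𝒳̃ D‖₁`, `m = ⌊n/2⌋`, for all symmetric `D` with `‖D‖_* ≤ 5√r ‖D‖_F`. None of the
three mentions `A`, so the event serves all `A` at once.

On that event every symmetric `A` is feasible, so a minimizer `M` exists and `D = M - A` does not
increase the nuclear norm of `A`. Trace duality with a block test matrix
(`IsSVD.nuclearNorm_le_of_le`) gives `‖D‖_* ≤ 3√r ‖D‖_F + 2t`, where `t` is the nuclear norm of the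
tail. Either `√r ‖D‖_F ≤ t`, which is already the claim, or `D` lies in the cone above. In the cone,
the `ℓ₁` constraint bounds `‖𝒳̃ D‖₁` by `2nσ` and hence `‖D‖_F` by a multiple of `σ`. The Dantzig
constraint gives `‖𝒳̃ D‖₂² ≤ 2η‖D‖_*`, and Cauchy-Schwarz turns this into `‖D‖_F ≲ √r η / n`. The
two bounds are the two arguments of the minimum (`error_bound`).

The probabilistic core is the uniform lower bound. Put `Y_D = ⟨D, bbᵀ - b'b'ᵀ⟩` with `‖D‖_F = 1`.
Its characteristic function at `1` is the squared modulus of that of a Gaussian quadratic form,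
hence at most `1/√5`; since `1 - cos x ≤ |x|`, this forces `E|Y_D| ≥ 1/2`. Swapping `b` and `b'`
changes the sign of `Y_D`, so each pair symmetrizes itself. One variable at a time, weighted suprema
of `exp(l(1/2 - |Y_D|))` are dominated in mean by those of `exp(2l Y_D)` (`lintegral_iSup_exp_le`,
`lintegral_iSup_prod_le`). With the absolute values gone, duality on the cone leaves only the
exponential moment of `‖∑ (bbᵀ - b'b'ᵀ)‖`, which a net and the chi-square moment generating function
control (`lintegral_exp_specNorm_le`). The same moment bound, conditionally on the noise, controls
the dual noise. -/

/-- The Frobenius inner product. -/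
noncomputable def frobInner {p : ℕ} (M N : Matrix (Fin p) (Fin p) ℝ) : ℝ :=
  ∑ i, ∑ j, M i j * N i j

/-! ### Trace duality between the nuclear and spectral norms -/

section FrobInner

variable {p : ℕ}

/-- A matrix as an operator on Euclidean space. -/
noncomputable abbrev toOp (M : Matrix (Fin p) (Fin p) ℝ) :
    EuclideanSpace ℝ (Fin p) →L[ℝ] EuclideanSpace ℝ (Fin p) :=
  Matrix.toEuclideanCLM (n := Fin p) (𝕜 := ℝ) M

theorem frobeniusNorm_nonneg (M : Matrix (Fin p) (Fin p) ℝ) : 0 ≤ frobeniusNorm M :=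
  Real.sqrt_nonneg _

theorem frobeniusNorm_sq (M : Matrix (Fin p) (Fin p) ℝ) :
    frobeniusNorm M ^ 2 = ∑ i, ∑ j, M i j ^ 2 :=
  Real.sq_sqrt (Finset.sum_nonneg fun _ _ => Finset.sum_nonneg fun _ _ => sq_nonneg _)

theorem frobInner_self (M : Matrix (Fin p) (Fin p) ℝ) : frobInner M M = frobeniusNorm M ^ 2 := by
  rw [frobeniusNorm_sq]
  simp [frobInner, sq]

theorem frobInner_add_left (M N B : Matrix (Fin p) (Fin p) ℝ) :
    frobInner (M + N) B = frobInner M B + frobInner N B := by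
  simp [frobInner, add_mul, Finset.sum_add_distrib]

theorem frobInner_sub_left (M N B : Matrix (Fin p) (Fin p) ℝ) :
    frobInner (M - N) B = frobInner M B - frobInner N B := by
  simp [frobInner, sub_mul, Finset.sum_sub_distrib]

theorem frobInner_sub_right (M N B : Matrix (Fin p) (Fin p) ℝ) :
    frobInner M (N - B) = frobInner M N - frobInner M B := by
  simp [frobInner, mul_sub, Finset.sum_sub_distrib]

theorem frobInner_smul_left (c : ℝ) (M B : Matrix (Fin p) (Fin p) ℝ) :
    frobInner (c • M) B = c * frobInner M B := by
  simp [frobInner, mul_assoc, Finset.mul_sum]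

theorem frobInner_smul_right (c : ℝ) (M B : Matrix (Fin p) (Fin p) ℝ) :
    frobInner M (c • B) = c * frobInner M B := by
  simp [frobInner, mul_left_comm, Finset.mul_sum]

theorem frobInner_sum_right {ι : Type*} (s : Finset ι) (M : Matrix (Fin p) (Fin p) ℝ)
    (B : ι → Matrix (Fin p) (Fin p) ℝ) :
    frobInner M (∑ k ∈ s, B k) = ∑ k ∈ s, frobInner M (B k) := by
  classical
  induction s using Finset.induction_on with
  | empty => simp [frobInner]
  | insert a s ha ih =>
    rw [Finset.sum_insert ha, Finset.sum_insert ha, ← ih]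
    simp [frobInner, mul_add, Finset.sum_add_distrib]

theorem frobInner_vecMulVec (M : Matrix (Fin p) (Fin p) ℝ) (x y : Fin p → ℝ) :
    frobInner M (Matrix.vecMulVec x y) = x ⬝ᵥ (M *ᵥ y) := by
  simp only [frobInner, Matrix.vecMulVec_apply, dotProduct, Matrix.mulVec, Finset.mul_sum]
  exact Finset.sum_congr rfl fun i _ => Finset.sum_congr rfl fun j _ => by ring

/-- Both sides are the trace of `M* N`. Freedom of basis is the point: duality uses the right
singular vectors of `M`, the cone estimate those of `A`. -/
theorem frobInner_eq_sum_inner {ι : Type*} [Fintype ι]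
    (b : OrthonormalBasis ι ℝ (EuclideanSpace ℝ (Fin p))) (M N : Matrix (Fin p) (Fin p) ℝ) :
    frobInner M N = ∑ k, ⟪toOp M (b k), toOp N (b k)⟫ := by
  have h1 : LinearMap.trace ℝ _
      ((ContinuousLinearMap.adjoint (toOp M) ∘L toOp N :
        EuclideanSpace ℝ (Fin p) →L[ℝ] EuclideanSpace ℝ (Fin p)) :
        EuclideanSpace ℝ (Fin p) →ₗ[ℝ] EuclideanSpace ℝ (Fin p)) =
      ∑ k, ⟪toOp M (b k), toOp N (b k)⟫ := by
    rw [LinearMap.trace_eq_sum_inner _ b]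
    exact Finset.sum_congr rfl fun k _ => by
      simp [ContinuousLinearMap.adjoint_inner_right]
  rw [← h1, LinearMap.trace_eq_sum_inner _ (EuclideanSpace.basisFun (Fin p) ℝ), frobInner,
    Finset.sum_comm]
  refine Finset.sum_congr rfl fun k _ => ?_
  simp only [ContinuousLinearMap.coe_coe, ContinuousLinearMap.comp_apply,
    ContinuousLinearMap.adjoint_inner_right, PiLp.inner_apply]
  refine Finset.sum_congr rfl fun i _ => ?_
  simp [toOp, EuclideanSpace.basisFun_apply, mul_comm]

theorem frobeniusNorm_sq_eq_sum {ι : Type*} [Fintype ι]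
    (b : OrthonormalBasis ι ℝ (EuclideanSpace ℝ (Fin p))) (M : Matrix (Fin p) (Fin p) ℝ) :
    frobeniusNorm M ^ 2 = ∑ k, ‖toOp M (b k)‖ ^ 2 := by
  rw [← frobInner_self, frobInner_eq_sum_inner b]
  simp

theorem norm_toOp_le (M : Matrix (Fin p) (Fin p) ℝ) (x : EuclideanSpace ℝ (Fin p)) :
    ‖toOp M x‖ ≤ specNorm M * ‖x‖ :=
  (toOp M).le_opNorm x

/-- Trace duality: the nuclear norm dominates every pairing with a contraction. -/
theorem frobInner_le_nuclearNorm (M B : Matrix (Fin p) (Fin p) ℝ) :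
    frobInner M B ≤ nuclearNorm M * specNorm B := by
  have hs := (Matrix.toEuclideanLin M).isSymmetric_adjoint_comp_self
  have hn : Module.finrank ℝ (EuclideanSpace ℝ (Fin p)) = p := by simp
  let b := hs.eigenvectorBasis hn
  -- In the eigenbasis of `M* M` the vectors `M b_k` have the singular values as lengths, so duality
  -- becomes termwise Cauchy-Schwarz.
  have hnorm : ∀ k, ‖toOp M (b k)‖ = (Matrix.toEuclideanLin M).singularValues k := by
    intro k
    rw [← sq_eq_sq₀ (norm_nonneg _) (LinearMap.singularValues_nonneg _ _),
      LinearMap.sq_singularValues_fin _ hn, ← real_inner_self_eq_norm_sq]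
    have h1 : ⟪toOp M (b k), toOp M (b k)⟫ =
        ⟪b k, (LinearMap.adjoint (Matrix.toEuclideanLin M) ∘ₗ Matrix.toEuclideanLin M) (b k)⟫ := by
      rw [LinearMap.comp_apply, LinearMap.adjoint_inner_right]
      rfl
    rw [h1, hs.apply_eigenvectorBasis hn k, inner_smul_right, real_inner_self_eq_norm_sq,
      b.norm_eq_one]
    simp
  rw [frobInner_eq_sum_inner b, nuclearNorm, ← Fin.sum_univ_eq_sum_range
    (fun i => (Matrix.toEuclideanLin M).singularValues i), Finset.sum_mul]
  refine Finset.sum_le_sum fun k _ => (real_inner_le_norm _ _).trans ?_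
  rw [hnorm k]
  refine mul_le_mul_of_nonneg_left ?_ (LinearMap.singularValues_nonneg _ _)
  simpa using norm_toOp_le B (b k)

theorem specNorm_le_one {B : Matrix (Fin p) (Fin p) ℝ} (h : ∀ x, ‖toOp B x‖ ≤ ‖x‖) :
    specNorm B ≤ 1 :=
  ContinuousLinearMap.opNorm_le_bound _ zero_le_one fun x => by simpa using h x

/-- The supremum in trace duality is attained. -/
theorem exists_frobInner_eq_nuclearNorm (M : Matrix (Fin p) (Fin p) ℝ) :
    ∃ B, specNorm B ≤ 1 ∧ frobInner M B = nuclearNorm M := by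
  have hs := (Matrix.toEuclideanLin M).isSymmetric_adjoint_comp_self
  have hn : Module.finrank ℝ (EuclideanSpace ℝ (Fin p)) = p := by simp
  let b := hs.eigenvectorBasis hn
  set s : Fin p → ℝ := fun k => (Matrix.toEuclideanLin M).singularValues k with hsdef
  have hs0 : ∀ k, 0 ≤ s k := fun k => LinearMap.singularValues_nonneg _ _
  have hinner : ∀ k l, ⟪toOp M (b k), toOp M (b l)⟫ = if k = l then s l ^ 2 else 0 := by
    intro k l
    have h1 : ⟪toOp M (b k), toOp M (b l)⟫ =
        ⟪b k, (LinearMap.adjoint (Matrix.toEuclideanLin M) ∘ₗ Matrix.toEuclideanLin M) (b l)⟫ := by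
      rw [LinearMap.comp_apply, LinearMap.adjoint_inner_right]
      rfl
    rw [h1, hs.apply_eigenvectorBasis hn l, inner_smul_right, b.inner_eq_ite, hsdef]
    simp only
    rw [LinearMap.sq_singularValues_fin _ hn]
    split_ifs <;> simp
  -- The partial isometry of the polar decomposition: `b_k ↦ M b_k / s_k`. The convention `0⁻¹ = 0`
  -- makes it vanish on the kernel of `M`.
  let T : EuclideanSpace ℝ (Fin p) →ₗ[ℝ] EuclideanSpace ℝ (Fin p) :=
    b.toBasis.constr ℝ fun k => (s k)⁻¹ • toOp M (b k)
  have hT : ∀ k, T (b k) = (s k)⁻¹ • toOp M (b k) := fun k => by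
    have h := b.toBasis.constr_basis ℝ (fun k => (s k)⁻¹ • toOp M (b k)) k
    rwa [b.coe_toBasis] at h
  let B : Matrix (Fin p) (Fin p) ℝ :=
    (Matrix.toEuclideanCLM (n := Fin p) (𝕜 := ℝ)).symm (LinearMap.toContinuousLinearMap T)
  have hB : ∀ x, toOp B x = T x := fun x => by simp [toOp, B]
  refine ⟨B, specNorm_le_one fun x => ?_, ?_⟩
  · rw [hB]
    have hx : T x = ∑ k, ⟪b k, x⟫ • (s k)⁻¹ • toOp M (b k) := by
      conv_lhs => rw [← b.sum_repr' x]
      simp [hT]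
    have h2 : ‖T x‖ ^ 2 ≤ ‖x‖ ^ 2 := by
      rw [← b.sum_sq_inner_right x, ← real_inner_self_eq_norm_sq, hx, sum_inner]
      refine Finset.sum_le_sum fun k _ => ?_
      rw [inner_sum, Finset.sum_eq_single k]
      · simp only [inner_smul_left, inner_smul_right, hinner, if_true, RCLike.conj_to_real]
        rcases eq_or_ne (s k) 0 with h | h
        · simp only [h]
          simp
          positivity
        · field_simp
          rfl
      · intro l _ hl
        simp only [inner_smul_left, inner_smul_right, hinner, if_neg hl.symm]
        simp
      · simp
    exact le_of_sq_le_sq h2 (norm_nonneg _)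
  · rw [frobInner_eq_sum_inner b, nuclearNorm, ← Fin.sum_univ_eq_sum_range
      (fun i => (Matrix.toEuclideanLin M).singularValues i)]
    refine Finset.sum_congr rfl fun k _ => ?_
    rw [hB, hT, inner_smul_right, hinner, if_pos rfl]
    change _ = s k
    rcases eq_or_ne (s k) 0 with h | h
    · simp [h]
    · field_simp

theorem nuclearNorm_nonneg (M : Matrix (Fin p) (Fin p) ℝ) : 0 ≤ nuclearNorm M :=
  Finset.sum_nonneg fun _ _ => LinearMap.singularValues_nonneg _ _

theorem nuclearNorm_smul_le {c : ℝ} (hc : 0 ≤ c) (M : Matrix (Fin p) (Fin p) ℝ) :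
    nuclearNorm (c • M) ≤ c * nuclearNorm M := by
  obtain ⟨B, hB, h⟩ := exists_frobInner_eq_nuclearNorm (c • M)
  rw [← h, frobInner_smul_left]
  refine mul_le_mul_of_nonneg_left ((frobInner_le_nuclearNorm M B).trans ?_) hc
  exact mul_le_of_le_one_right (nuclearNorm_nonneg M) hB

theorem abs_apply_le_specNorm (B : Matrix (Fin p) (Fin p) ℝ) (i j : Fin p) :
    |B i j| ≤ specNorm B := by
  have h1 := norm_toOp_le B (EuclideanSpace.single j (1 : ℝ))
  have h2 : ‖toOp B (EuclideanSpace.single j (1 : ℝ)) i‖ ≤ _ := PiLp.norm_apply_le _ i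
  simp only [toOp, Matrix.ofLp_toEuclideanCLM, PiLp.ofLp_single, Matrix.mulVec_single_one,
    Real.norm_eq_abs, Matrix.col_apply] at h2
  simpa using h2.trans h1

theorem specNorm_le_frobeniusNorm (B : Matrix (Fin p) (Fin p) ℝ) :
    specNorm B ≤ frobeniusNorm B := by
  refine ContinuousLinearMap.opNorm_le_bound _ (frobeniusNorm_nonneg _) fun x => ?_
  refine le_of_sq_le_sq ?_ (mul_nonneg (frobeniusNorm_nonneg _) (norm_nonneg _))
  rw [mul_pow, frobeniusNorm_sq, EuclideanSpace.norm_sq_eq, EuclideanSpace.norm_sq_eq,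
    Finset.sum_mul]
  refine Finset.sum_le_sum fun i _ => ?_
  simp only [Matrix.ofLp_toEuclideanCLM, Real.norm_eq_abs, sq_abs, Matrix.mulVec, dotProduct]
  exact Finset.sum_mul_sq_le_sq_mul_sq _ _ _

theorem frobeniusNorm_le_nuclearNorm (M : Matrix (Fin p) (Fin p) ℝ) :
    frobeniusNorm M ≤ nuclearNorm M := by
  rcases (frobeniusNorm_nonneg M).eq_or_lt with h | h
  · rw [← h]; exact nuclearNorm_nonneg M
  · have h1 := frobInner_le_nuclearNorm M M
    rw [frobInner_self] at h1
    have h2 := mul_le_mul_of_nonneg_left (specNorm_le_frobeniusNorm M) (nuclearNorm_nonneg M)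
    nlinarith

theorem continuous_specNorm : Continuous (specNorm (p := p)) := by
  have h : Continuous fun M : Matrix (Fin p) (Fin p) ℝ => toOp M :=
    LinearMap.continuous_of_finiteDimensional
      (Matrix.toEuclideanCLM (n := Fin p) (𝕜 := ℝ)).toAlgEquiv.toLinearMap
  exact h.norm

/-- Pair `M - N` with the contraction that attains the nuclear norm of `M`; its entries are at most
one in absolute value. This crude entrywise bound is all that continuity needs. -/
theorem nuclearNorm_sub_le (M N : Matrix (Fin p) (Fin p) ℝ) :
    nuclearNorm M - nuclearNorm N ≤ ∑ i, ∑ j, |M i j - N i j| := by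
  obtain ⟨B, hB, h⟩ := exists_frobInner_eq_nuclearNorm M
  have h1 := frobInner_le_nuclearNorm N B
  have h2 : nuclearNorm N * specNorm B ≤ nuclearNorm N :=
    mul_le_of_le_one_right (nuclearNorm_nonneg N) hB
  have h3 : frobInner M B - frobInner N B ≤ ∑ i, ∑ j, |M i j - N i j| := by
    rw [← frobInner_sub_left, frobInner]
    refine Finset.sum_le_sum fun i _ => Finset.sum_le_sum fun j _ => ?_
    refine (le_abs_self _).trans ?_
    rw [abs_mul, Matrix.sub_apply]
    exact mul_le_of_le_one_right (abs_nonneg _) ((abs_apply_le_specNorm B i j).trans hB)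
  linarith

theorem continuous_nuclearNorm : Continuous (nuclearNorm (p := p)) := by
  rw [continuous_iff_continuousAt]
  intro M
  rw [ContinuousAt, tendsto_iff_dist_tendsto_zero]
  have hc : Continuous fun N : Matrix (Fin p) (Fin p) ℝ => ∑ i, ∑ j, |N i j - M i j| := by
    fun_prop
  have h0 := hc.tendsto M
  simp only [sub_self, abs_zero, Finset.sum_const_zero] at h0
  refine squeeze_zero (fun _ => dist_nonneg) (fun N => ?_) h0
  rw [Real.dist_eq]
  refine abs_le.2 ⟨?_, nuclearNorm_sub_le N M⟩
  have := nuclearNorm_sub_le M N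
  simp_rw [abs_sub_comm (M _ _)] at this
  linarith

end FrobInner

/-! ### The cone condition for the error matrix -/

section Cone

variable {p : ℕ}

/-- An orthonormal family indexed by `Fin p` as an orthonormal basis of `ℝ^p`. -/
noncomputable def basisOfOrthonormal (u : Fin p → EuclideanSpace ℝ (Fin p))
    (hu : Orthonormal ℝ u) : OrthonormalBasis (Fin p) ℝ (EuclideanSpace ℝ (Fin p)) :=
  OrthonormalBasis.mk hu (by
    rcases Nat.eq_zero_or_pos p with rfl | hp
    · exact (Subsingleton.elim _ _).le
    · have : Nonempty (Fin p) := ⟨⟨0, hp⟩⟩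
      exact (hu.linearIndependent.span_eq_top_of_card_eq_finrank' (by simp)).ge)

theorem basisOfOrthonormal_apply (u : Fin p → EuclideanSpace ℝ (Fin p))
    (hu : Orthonormal ℝ u) (i : Fin p) : basisOfOrthonormal u hu i = u i := by
  simp [basisOfOrthonormal]

theorem toOp_vecMulVec (u v x : EuclideanSpace ℝ (Fin p)) :
    toOp (Matrix.vecMulVec u v) x = ⟪v, x⟫ • u := by
  ext i
  simp [toOp, Matrix.vecMulVec_mulVec, PiLp.inner_apply, dotProduct, mul_comm]

theorem frobInner_svd_sum (s : Finset (Fin p)) (a : Fin p → ℝ)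
    (u v : Fin p → EuclideanSpace ℝ (Fin p)) (B : Matrix (Fin p) (Fin p) ℝ) :
    frobInner (∑ i ∈ s, a i • Matrix.vecMulVec (u i) (v i)) B =
      ∑ i ∈ s, a i * ⟪u i, toOp B (v i)⟫ := by
  have hcomm : ∀ M N : Matrix (Fin p) (Fin p) ℝ, frobInner M N = frobInner N M := fun M N => by
    simp [frobInner, mul_comm]
  rw [hcomm, frobInner_sum_right]
  refine Finset.sum_congr rfl fun i _ => ?_
  rw [frobInner_smul_right, frobInner_vecMulVec]
  congr 1
  rw [Matrix.inner_toEuclideanCLM]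

/-- By duality, since each `⟪u_i, B v_i⟫` is at most one for a contraction `B`. Working with
inequalities avoids identifying the given `a` with the canonical singular values. -/
theorem IsSVD.nuclearNorm_le {A : Matrix (Fin p) (Fin p) ℝ} {a : Fin p → ℝ}
    {u v : Fin p → EuclideanSpace ℝ (Fin p)} (h : IsSVD A a u v) :
    nuclearNorm A ≤ ∑ i, a i := by
  obtain ⟨B, hB, hAB⟩ := exists_frobInner_eq_nuclearNorm A
  rw [← hAB, h.eq_sum, frobInner_svd_sum]
  refine Finset.sum_le_sum fun i _ => mul_le_of_le_one_right (h.nonneg i) ?_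
  refine (real_inner_le_norm _ _).trans ?_
  have h1 := norm_toOp_le B (v i)
  rw [h.orthonormal_right.1 i, mul_one] at h1
  rw [h.orthonormal_left.1 i, one_mul]
  exact h1.trans hB

/-- The tail sum of singular values is at most the nuclear norm of the tail. -/
theorem IsSVD.sum_tail_le {A : Matrix (Fin p) (Fin p) ℝ} {a : Fin p → ℝ}
    {u v : Fin p → EuclideanSpace ℝ (Fin p)} (h : IsSVD A a u v) (r : ℕ) :
    ∑ i ∈ Finset.univ.filter (fun i : Fin p => r ≤ (i : ℕ)), a i ≤
      nuclearNorm (svdTail r a u v) := by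
  set bu := basisOfOrthonormal u h.orthonormal_left
  set bv := basisOfOrthonormal v h.orthonormal_right
  -- The isometry carrying each `v_i` to `u_i`; pairing the tail with it recovers the sum of its
  -- coefficients.
  let e := bv.equiv bu (Equiv.refl _)
  let B : Matrix (Fin p) (Fin p) ℝ :=
    (Matrix.toEuclideanCLM (n := Fin p) (𝕜 := ℝ)).symm (e.toContinuousLinearEquiv : _ →L[ℝ] _)
  have hB : ∀ x, toOp B x = e x := fun x => by simp [toOp, B]
  have hs : specNorm B ≤ 1 := specNorm_le_one fun x => by rw [hB, e.norm_map]
  have h1 := frobInner_le_nuclearNorm (svdTail r a u v) B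
  rw [svdTail, frobInner_svd_sum] at h1
  have h2 : ∀ i, ⟪u i, toOp B (v i)⟫ = 1 := by
    intro i
    have : e (v i) = u i := by
      rw [← basisOfOrthonormal_apply v h.orthonormal_right,
        ← basisOfOrthonormal_apply u h.orthonormal_left]
      simp [e, bu, bv]
    rw [hB, this, real_inner_self_eq_norm_sq, h.orthonormal_left.1 i, one_pow]
  simp only [h2, mul_one] at h1
  exact h1.trans (mul_le_of_le_one_right (nuclearNorm_nonneg _) hs)

/-- If adding `D` does not increase the nuclear norm of `A`, the nuclear norm of `D` is controlled
by its Frobenius norm up to the tail of the singular values of `A`. -/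
theorem IsSVD.nuclearNorm_le_of_le {A D : Matrix (Fin p) (Fin p) ℝ} {a : Fin p → ℝ}
    {u v : Fin p → EuclideanSpace ℝ (Fin p)} (h : IsSVD A a u v)
    (hAD : nuclearNorm (A + D) ≤ nuclearNorm A) (r : ℕ) :
    nuclearNorm D ≤ 3 * √r * frobeniusNorm D + 2 * nuclearNorm (svdTail r a u v) := by
  set bu := basisOfOrthonormal u h.orthonormal_left with hbu
  set bv := basisOfOrthonormal v h.orthonormal_right with hbv
  have bu_apply : ∀ i, bu i = u i := basisOfOrthonormal_apply u h.orthonormal_left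
  have bv_apply : ∀ i, bv i = v i := basisOfOrthonormal_apply v h.orthonormal_right
  set S : Finset (Fin p) := Finset.univ.filter (fun i : Fin p => (i : ℕ) < r) with hS
  set S' : Finset (Fin p) := Finset.univ.filter (fun i : Fin p => r ≤ (i : ℕ)) with hS'
  have hsplit : ∀ f : Fin p → ℝ, ∑ i, f i = ∑ i ∈ S, f i + ∑ i ∈ S', f i := fun f => by
    rw [← Finset.sum_filter_add_sum_filter_not Finset.univ (fun i : Fin p => (i : ℕ) < r)]
    simp [hS, hS']
  have hcard : (S.card : ℝ) ≤ r := by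
    have h1 : S.card ≤ (Finset.range r).card :=
      Finset.card_le_card_of_injOn (fun i => (i : ℕ)) (fun i hi => by simpa [hS] using hi)
        (fun i _ j _ hij => Fin.ext hij)
    rw [Finset.card_range] at h1
    exact_mod_cast h1
  obtain ⟨B, hB, hDB⟩ := exists_frobInner_eq_nuclearNorm D
  have hBn : ∀ x, ‖toOp B x‖ ≤ ‖x‖ := fun x =>
    (norm_toOp_le B x).trans (mul_le_of_le_one_left (norm_nonneg _) hB)
  -- the test matrix: `u_k v_kᵀ` on the leading block, the compression of `B` on the other
  let W : Matrix (Fin p) (Fin p) ℝ := ∑ k ∈ S, Matrix.vecMulVec (u k) (v k) +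
    ∑ k ∈ S', ∑ i ∈ S', ⟪u i, toOp B (v k)⟫ • Matrix.vecMulVec (u i) (v k)
  have hWx : ∀ x, toOp W x = ∑ k ∈ S, ⟪v k, x⟫ • u k +
      ∑ i ∈ S', ⟪u i, toOp B (∑ k ∈ S', ⟪v k, x⟫ • v k)⟫ • u i := by
    intro x
    have h1 : toOp W x = ∑ k ∈ S, toOp (Matrix.vecMulVec (u k) (v k)) x +
        ∑ k ∈ S', ∑ i ∈ S', ⟪u i, toOp B (v k)⟫ • toOp (Matrix.vecMulVec (u i) (v k)) x := by
      simp [toOp, W, map_sum]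
    rw [h1]
    simp only [toOp_vecMulVec]
    congr 1
    rw [Finset.sum_comm]
    refine Finset.sum_congr rfl fun i _ => ?_
    rw [map_sum, inner_sum, Finset.sum_smul]
    refine Finset.sum_congr rfl fun k _ => ?_
    rw [map_smul, inner_smul_right, smul_smul, mul_comm]
  have hnormsq : ∀ (b : OrthonormalBasis (Fin p) ℝ (EuclideanSpace ℝ (Fin p)))
      (T : Finset (Fin p)) (f : Fin p → ℝ), ‖∑ i ∈ T, f i • b i‖ ^ 2 = ∑ i ∈ T, f i ^ 2 := by
    intro b T f
    rw [← real_inner_self_eq_norm_sq, b.orthonormal.inner_sum]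
    simp [sq]
  have hWu : ∀ x k, ⟪u k, toOp W x⟫ = if k ∈ S then ⟪v k, x⟫ else
      ⟪u k, toOp B (∑ k ∈ S', ⟪v k, x⟫ • v k)⟫ := by
    intro x k
    have hmem : k ∈ S' ↔ k ∉ S := by simp [hS, hS']
    rw [hWx, inner_add_right, inner_sum, inner_sum]
    simp only [inner_smul_right, orthonormal_iff_ite.1 h.orthonormal_left, mul_ite, mul_one,
      mul_zero, Finset.sum_ite_eq, hmem]
    split_ifs <;> simp
  -- Between the bases `v` and `u`, `W` is block diagonal: the identity on the leading block and a
  -- compression of the contraction `B` on the other.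
  have hW : specNorm W ≤ 1 := by
    refine specNorm_le_one fun x => le_of_sq_le_sq ?_ (norm_nonneg _)
    rw [← bu.sum_sq_inner_right, ← bv.sum_sq_inner_right x, hsplit, hsplit]
    refine add_le_add (Finset.sum_le_sum fun k hk => ?_) ?_
    · rw [bu_apply, bv_apply, hWu, if_pos hk]
    · calc ∑ i ∈ S', ⟪bu i, toOp W x⟫ ^ 2
          = ∑ i ∈ S', ⟪bu i, toOp B (∑ k ∈ S', ⟪v k, x⟫ • v k)⟫ ^ 2 := by
            refine Finset.sum_congr rfl fun k hk => ?_
            have hk' : k ∉ S := by simpa [hS, hS'] using hk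
            rw [bu_apply, hWu, if_neg hk']
        _ ≤ ∑ i, ⟪bu i, toOp B (∑ k ∈ S', ⟪v k, x⟫ • v k)⟫ ^ 2 :=
            Finset.sum_le_univ_sum_of_nonneg fun _ => sq_nonneg _
        _ = ‖toOp B (∑ k ∈ S', ⟪v k, x⟫ • v k)‖ ^ 2 := bu.sum_sq_inner_right _
        _ ≤ ‖∑ k ∈ S', ⟪v k, x⟫ • v k‖ ^ 2 := by
            gcongr
            exact hBn _
        _ = ∑ i ∈ S', ⟪bv i, x⟫ ^ 2 := by
            simp only [← bv_apply]
            rw [hnormsq]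
  have hF := frobeniusNorm_sq_eq_sum bv D
  have hF0 := frobeniusNorm_nonneg D
  -- the pairings of `D` with `B` and with `W` differ by little
  have hAW : ∑ i ∈ S, a i - ∑ i ∈ S', a i ≤ frobInner A W := by
    rw [h.eq_sum, frobInner_svd_sum, hsplit, sub_eq_add_neg, ← Finset.sum_neg_distrib]
    refine add_le_add (Finset.sum_le_sum fun k hk => ?_) (Finset.sum_le_sum fun k _ => ?_)
    · rw [hWu, if_pos hk, real_inner_self_eq_norm_sq, h.orthonormal_right.1 k]
      simp
    · have h1 : |⟪u k, toOp W (v k)⟫| ≤ 1 := by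
        refine (abs_real_inner_le_norm _ _).trans ?_
        have h2 := norm_toOp_le W (v k)
        rw [h.orthonormal_right.1 k, mul_one] at h2
        rw [h.orthonormal_left.1 k, one_mul]
        exact h2.trans hW
      nlinarith [(abs_le.1 h1).1, h.nonneg k]
  have hDW : frobInner D B - frobInner D W ≤ 3 * √r * frobeniusNorm D := by
    have hdiff : frobInner D B - frobInner D W =
        ∑ k ∈ S, ⟪toOp D (v k), toOp B (v k) - u k⟫ +
          ∑ k ∈ S', ∑ i ∈ S, ⟪toOp D (v k), u i⟫ * ⟪u i, toOp B (v k)⟫ := by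
      rw [frobInner_eq_sum_inner bv, frobInner_eq_sum_inner bv, ← Finset.sum_sub_distrib, hsplit]
      simp only [bv_apply, ← inner_sub_right]
      congr 1
      · refine Finset.sum_congr rfl fun k hk => ?_
        have h0 : ∑ l ∈ S', ⟪v l, v k⟫ • v l = 0 := Finset.sum_eq_zero fun l hl => by
          have hlk : l ≠ k := by
            rintro rfl
            simp only [hS, hS', Finset.mem_filter, Finset.mem_univ, true_and] at hk hl
            omega
          rw [h.orthonormal_right.2 hlk, zero_smul]
        rw [hWx, h0]
        simp [orthonormal_iff_ite.1 h.orthonormal_right, hk]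
      · refine Finset.sum_congr rfl fun k hk => ?_
        have hk' : k ∉ S := by simpa [hS, hS'] using hk
        have hW2 : toOp W (v k) = ∑ i ∈ S', ⟪u i, toOp B (v k)⟫ • u i := by
          rw [hWx]
          simp [orthonormal_iff_ite.1 h.orthonormal_right, hk, hk']
        have hB2 : toOp B (v k) = ∑ i ∈ S, ⟪u i, toOp B (v k)⟫ • u i +
            ∑ i ∈ S', ⟪u i, toOp B (v k)⟫ • u i := by
          conv_lhs => rw [← bu.sum_repr' (toOp B (v k))]
          rw [← Finset.sum_filter_add_sum_filter_not Finset.univ (fun i : Fin p => (i : ℕ) < r)]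
          simp [hS, hS', bu_apply]
        have hd : toOp B (v k) - toOp W (v k) = ∑ i ∈ S, ⟪u i, toOp B (v k)⟫ • u i := by
          rw [hW2, sub_eq_iff_eq_add]
          exact hB2
        rw [hd, inner_sum]
        exact Finset.sum_congr rfl fun i _ => by rw [inner_smul_right, mul_comm]
    have hT1 : ∑ k ∈ S, ⟪toOp D (v k), toOp B (v k) - u k⟫ ≤ 2 * √r * frobeniusNorm D := by
      have e1 : ∑ k ∈ S, ⟪toOp D (v k), toOp B (v k) - u k⟫ ≤ 2 * ∑ k ∈ S, ‖toOp D (v k)‖ := by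
        rw [Finset.mul_sum]
        refine Finset.sum_le_sum fun k _ => (real_inner_le_norm _ _).trans ?_
        have e2 : ‖toOp B (v k) - u k‖ ≤ 2 := by
          refine (norm_sub_le _ _).trans ?_
          have e3 := hBn (v k)
          rw [h.orthonormal_right.1 k] at e3
          rw [h.orthonormal_left.1 k]
          linarith
        nlinarith [norm_nonneg (toOp D (v k))]
      have e4 : ∑ k ∈ S, ‖toOp D (v k)‖ ≤ √r * frobeniusNorm D := by
        refine le_of_sq_le_sq ?_ (by positivity)
        rw [mul_pow, Real.sq_sqrt (Nat.cast_nonneg r), hF]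
        refine (sq_sum_le_card_mul_sum_sq).trans ?_
        simp only [bv_apply]
        exact mul_le_mul hcard (Finset.sum_le_univ_sum_of_nonneg fun _ => sq_nonneg _)
          (Finset.sum_nonneg fun _ _ => sq_nonneg _) (Nat.cast_nonneg r)
      linarith
    -- Cauchy-Schwarz over the off-diagonal block. Each of its at most `r` rows has squared length
    -- at most `‖B* u_i‖² ≤ 1`, so the block of `B` has Frobenius norm at most `√r`.
    have hT2 : ∑ k ∈ S', ∑ i ∈ S, ⟪toOp D (v k), u i⟫ * ⟪u i, toOp B (v k)⟫ ≤
        √r * frobeniusNorm D := by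
      refine le_of_sq_le_sq ?_ (by positivity)
      rw [mul_pow, Real.sq_sqrt (Nat.cast_nonneg r), ← Finset.sum_product', mul_comm]
      refine (Finset.sum_mul_sq_le_sq_mul_sq _ _ _).trans ?_
      rw [Finset.sum_product, Finset.sum_product]
      refine mul_le_mul ?_ ?_ (Finset.sum_nonneg fun _ _ => Finset.sum_nonneg fun _ _ =>
        sq_nonneg _) (sq_nonneg _)
      · rw [hF]
        refine (Finset.sum_le_univ_sum_of_nonneg fun _ => Finset.sum_nonneg fun _ _ =>
          sq_nonneg _).trans (Finset.sum_le_sum fun k _ => ?_)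
        rw [← bu.sum_sq_inner_left]
        simp only [bv_apply, bu_apply]
        exact Finset.sum_le_univ_sum_of_nonneg fun _ => sq_nonneg _
      · rw [Finset.sum_comm]
        refine le_trans (Finset.sum_le_card_nsmul S _ 1 fun i _ => ?_) (by simpa using hcard)
        have e1 : ‖ContinuousLinearMap.adjoint (toOp B) (u i)‖ ≤ 1 := by
          refine ((ContinuousLinearMap.adjoint (toOp B)).le_opNorm (u i)).trans ?_
          rw [h.orthonormal_left.1 i, mul_one, LinearIsometryEquiv.norm_map]
          exact hB
        calc ∑ k ∈ S', ⟪u i, toOp B (v k)⟫ ^ 2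
            = ∑ k ∈ S', ⟪ContinuousLinearMap.adjoint (toOp B) (u i), bv k⟫ ^ 2 := by
              simp only [ContinuousLinearMap.adjoint_inner_left, bv_apply]
          _ ≤ ∑ k, ⟪ContinuousLinearMap.adjoint (toOp B) (u i), bv k⟫ ^ 2 :=
              Finset.sum_le_univ_sum_of_nonneg fun _ => sq_nonneg _
          _ = ‖ContinuousLinearMap.adjoint (toOp B) (u i)‖ ^ 2 := bv.sum_sq_inner_left _
          _ ≤ 1 := pow_le_one₀ (norm_nonneg _) e1
    rw [hdiff]
    linarith
  -- Testing `A + D` against `W` gives `⟨A, W⟩ + ⟨D, W⟩ ≤ ‖A‖_*`. The leading singular values cancel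
  -- and `⟨D, W⟩` is at most twice the tail sum.
  have h1 := frobInner_le_nuclearNorm (A + D) W
  have h2 : nuclearNorm (A + D) * specNorm W ≤ nuclearNorm (A + D) :=
    mul_le_of_le_one_right (nuclearNorm_nonneg _) hW
  have h3 := h.nuclearNorm_le
  have h4 := h.sum_tail_le r
  rw [frobInner_add_left] at h1
  rw [hsplit] at h3
  rw [← hDB]
  linarith

end Cone

/-! ### Existence of the estimator and the error bound on the good event -/

section Deterministic

variable {n p : ℕ}

theorem pairDiff_sub (w w' : Fin n → ℝ) : pairDiff (w - w') = pairDiff w - pairDiff w' := by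
  ext i
  simp [pairDiff]
  ring

theorem design_sub (β : Fin n → Fin p → ℝ) (M N : Matrix (Fin p) (Fin p) ℝ) :
    design β (M - N) = design β M - design β N := by
  ext i
  simp [design, Matrix.sub_mulVec, dotProduct_sub]

theorem diffDual_sub (β : Fin n → Fin p → ℝ) (w w' : Fin (n / 2) → ℝ) :
    diffDual β (w - w') = diffDual β w - diffDual β w' := by
  simp [diffDual, sub_smul, Finset.sum_sub_distrib]

theorem frobInner_diffDual (β : Fin n → Fin p → ℝ) (w : Fin (n / 2) → ℝ)
    (M : Matrix (Fin p) (Fin p) ℝ) :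
    frobInner M (diffDual β w) = ∑ i, w i * diffDesign β M i := by
  rw [diffDual, frobInner_sum_right]
  simp [frobInner_smul_right, frobInner_sub_right, frobInner_vecMulVec, diffDesign, pairDiff,
    design]

theorem specNorm_sub_le (M N : Matrix (Fin p) (Fin p) ℝ) :
    specNorm (M - N) ≤ specNorm M + specNorm N := by
  rw [specNorm, map_sub]
  exact norm_sub_le _ _

theorem specNorm_smul (c : ℝ) (M : Matrix (Fin p) (Fin p) ℝ) :
    specNorm (c • M) = |c| * specNorm M := by
  rw [specNorm, map_smul, norm_smul, Real.norm_eq_abs, specNorm]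

theorem frobeniusNorm_smul (c : ℝ) (M : Matrix (Fin p) (Fin p) ℝ) :
    frobeniusNorm (c • M) = |c| * frobeniusNorm M := by
  rw [← sq_eq_sq₀ (frobeniusNorm_nonneg _) (mul_nonneg (abs_nonneg _) (frobeniusNorm_nonneg _)),
    mul_pow, ← frobInner_self, ← frobInner_self, frobInner_smul_left, frobInner_smul_right, sq_abs]
  ring

/-- Every summand of a paired sum occurs once in the full sum. -/
theorem sum_pairs_le {w : Fin n → ℝ} (hw : ∀ i, 0 ≤ w i) :
    ∑ i : Fin (n / 2), (w (fstIdx i) + w (sndIdx i)) ≤ ∑ i, w i := by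
  let f : Fin (n / 2) ⊕ Fin (n / 2) ↪ Fin n := ⟨Sum.elim fstIdx sndIdx, by
    rintro (i | i) (j | j) h <;>
    · have h' := congrArg Fin.val h
      simp only [Sum.elim_inl, Sum.elim_inr, fstIdx, sndIdx] at h'
      first
        | (congr 1; ext; omega)
        | omega⟩
  have h1 : ∑ x, w (f x) = ∑ i : Fin (n / 2), (w (fstIdx i) + w (sndIdx i)) := by
    rw [Fintype.sum_sum_type, Finset.sum_add_distrib]
    rfl
  rw [← h1, ← Finset.sum_map Finset.univ f w]
  exact Finset.sum_le_univ_sum_of_nonneg hw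

theorem sum_abs_pairDiff_le (w : Fin n → ℝ) : ∑ i, |pairDiff w i| ≤ ∑ i, |w i| :=
  (Finset.sum_le_sum fun _ _ => abs_sub _ _).trans (sum_pairs_le fun i => abs_nonneg (w i))

theorem continuous_design (β : Fin n → Fin p → ℝ) :
    Continuous fun M : Matrix (Fin p) (Fin p) ℝ => design β M := by
  refine continuous_pi fun i => ?_
  simp only [design, dotProduct, Matrix.mulVec]
  fun_prop

theorem isClosed_feasible (σ : ℝ) (β : Fin n → Fin p → ℝ) (y : Fin n → ℝ) :
    IsClosed (feasible σ β y) := by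
  have hd := continuous_design β
  have hdi : ∀ i, Continuous fun M : Matrix (Fin p) (Fin p) ℝ => design β M i :=
    fun i => (continuous_apply i).comp hd
  have hc : Continuous fun M : Matrix (Fin p) (Fin p) ℝ =>
      (∑ i, |y i - design β M i|) / n := by fun_prop
  refine IsClosed.inter (isClosed_eq continuous_id.matrix_transpose continuous_id)
    (IsClosed.inter (isClosed_le hc continuous_const) ?_)
  · refine isClosed_le (continuous_specNorm.comp ?_) continuous_const
    unfold diffDual diffDesign pairDiff
    simp only [Pi.sub_apply]
    fun_prop

theorem abs_apply_le_nuclearNorm (M : Matrix (Fin p) (Fin p) ℝ) (i j : Fin p) :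
    |M i j| ≤ nuclearNorm M := by
  refine le_trans (abs_le_of_sq_le_sq' ?_ (frobeniusNorm_nonneg M) |> abs_le.2)
    (frobeniusNorm_le_nuclearNorm M)
  rw [frobeniusNorm_sq]
  exact (Finset.single_le_sum (f := fun j => M i j ^ 2) (fun _ _ => sq_nonneg _)
    (Finset.mem_univ j)).trans (Finset.single_le_sum (f := fun i => ∑ j, M i j ^ 2)
      (fun _ _ => Finset.sum_nonneg fun _ _ => sq_nonneg _) (Finset.mem_univ i))

/-- A feasible point `A` confines the search to a nuclear-norm sublevel set, which is bounded
entrywise; its intersection with the closed feasible set is compact. -/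
theorem exists_isEstimator {σ : ℝ} {β : Fin n → Fin p → ℝ} {y : Fin n → ℝ}
    (h : (feasible σ β y).Nonempty) : ∃ M, IsEstimator σ β y M := by
  obtain ⟨A, hA⟩ := h
  have hbox : IsCompact ((Set.univ.pi fun _ => Set.univ.pi fun _ =>
      Set.Icc (-nuclearNorm A) (nuclearNorm A)) : Set (Matrix (Fin p) (Fin p) ℝ)) :=
    isCompact_univ_pi fun _ => isCompact_univ_pi fun _ => isCompact_Icc
  have hK : IsCompact (feasible σ β y ∩ {M | nuclearNorm M ≤ nuclearNorm A}) :=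
    hbox.of_isClosed_subset ((isClosed_feasible σ β y).inter
      (isClosed_le continuous_nuclearNorm continuous_const)) fun M hM i _ j _ =>
        abs_le.1 ((abs_apply_le_nuclearNorm M i j).trans hM.2)
  obtain ⟨M, hM, hmin⟩ := hK.exists_isMinOn ⟨A, hA, le_refl (nuclearNorm A)⟩ continuous_nuclearNorm.continuousOn
  refine ⟨M, hM.1, fun N hN => ?_⟩
  rcases le_total (nuclearNorm N) (nuclearNorm A) with h | h
  · exact hmin ⟨hN, h⟩
  · exact le_trans hM.2 h

/-- The restricted lower bound for the differenced design that drives the error bound. -/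
def RestrictedLowerBound (r : ℕ) (β : Fin n → Fin p → ℝ) : Prop :=
  ∀ D : Matrix (Fin p) (Fin p) ℝ, D.IsSymm → nuclearNorm D ≤ 5 * √r * frobeniusNorm D →
    ((n / 2 : ℕ) : ℝ) / 4 * frobeniusNorm D ≤ ∑ i, |diffDesign β D i|

theorem mem_feasible_of_noise {σ : ℝ} {β : Fin n → Fin p → ℝ} {z : Fin n → ℝ}
    {A : Matrix (Fin p) (Fin p) ℝ} (hA : A.IsSymm) (h1 : (∑ i, |z i|) / n ≤ σ)
    (h2 : specNorm (diffDual β (pairDiff z)) ≤ tuning n p σ) :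
    A ∈ feasible σ β (design β A + z) := by
  refine ⟨hA, by simpa using h1, ?_⟩
  rwa [diffDesign, ← pairDiff_sub, add_sub_cancel_left]

/-- From `(x + y)² ≤ 2x² + 2y²`; the constant is `9216 = 24² · 16`, set by the logarithmic term. -/
theorem tuning_sq_le {σ : ℝ} (hn : 1 ≤ n) :
    tuning n p σ ^ 2 ≤ 9216 * σ ^ 2 * (p * n + p ^ 2 * Real.log n) := by
  have hlog : 0 ≤ Real.log n := Real.log_natCast_nonneg n
  have h1 : √((p : ℝ) * n) ^ 2 = p * n := Real.sq_sqrt (by positivity)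
  have h2 : √(2 * Real.log n) ^ 2 = 2 * Real.log n := Real.sq_sqrt (by positivity)
  set x := √((p : ℝ) * n)
  set y := √(2 * Real.log n)
  rw [tuning]
  have h3 : (24 * σ * (x + 2 * p * y)) ^ 2 ≤ 576 * σ ^ 2 * (2 * x ^ 2 + 8 * p ^ 2 * y ^ 2) := by
    have : (x + 2 * p * y) ^ 2 ≤ 2 * x ^ 2 + 8 * p ^ 2 * y ^ 2 := by
      nlinarith [sq_nonneg (x - 2 * p * y)]
    nlinarith [mul_le_mul_of_nonneg_left this (by positivity : 0 ≤ 576 * σ ^ 2)]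
  rw [h1, h2] at h3
  refine h3.trans ?_
  have : (0 : ℝ) ≤ p * n := by positivity
  nlinarith [mul_nonneg (sq_nonneg σ) this]

/-- On the event where the noise is feasible and the design satisfies the restricted lower bound,
every estimator obeys the error bound. -/
theorem error_bound {r : ℕ} (hr : 1 ≤ r) (hn : 2 ≤ n) {σ : ℝ} (hσ : 0 ≤ σ)
    {β : Fin n → Fin p → ℝ} {z : Fin n → ℝ} (h1 : (∑ i, |z i|) / n ≤ σ)
    (h2 : specNorm (diffDual β (pairDiff z)) ≤ tuning n p σ)
    (h3 : RestrictedLowerBound r β) {A M : Matrix (Fin p) (Fin p) ℝ} (hA : A.IsSymm)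
    (hM : IsEstimator σ β (design β A + z) M) {a : Fin p → ℝ}
    {u v : Fin p → EuclideanSpace ℝ (Fin p)} (hsvd : IsSVD A a u v) :
    frobeniusNorm (M - A) ^ 2 ≤
      (230400 * 9216) * σ ^ 2 *
          min ((r : ℝ) * p ^ 2 * Real.log n / n ^ 2 + (r : ℝ) * p / n) 1 +
        1 * (nuclearNorm (svdTail r a u v) ^ 2 / r) := by
  have hr0 : (1 : ℝ) ≤ r := by exact_mod_cast hr
  have hn0 : (2 : ℝ) ≤ n := by exact_mod_cast hn
  have hm : (n : ℝ) ≤ 3 * ((n / 2 : ℕ) : ℝ) := by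
    have : n ≤ 3 * (n / 2) := by omega
    exact_mod_cast this
  set m : ℝ := ((n / 2 : ℕ) : ℝ) with hmdef
  have hm0 : 0 < m := by linarith
  set t := nuclearNorm (svdTail r a u v) with ht
  have ht0 : 0 ≤ t := nuclearNorm_nonneg _
  have hlog : 0 ≤ Real.log n := Real.log_natCast_nonneg n
  set D := M - A with hD
  have hF0 := frobeniusNorm_nonneg D
  set F := frobeniusNorm D
  have hsqr : √(r : ℝ) ^ 2 = r := Real.sq_sqrt (by linarith)
  have hsr0 : 0 < √(r : ℝ) := Real.sqrt_pos.2 (by linarith)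
  have hmin0 : 0 ≤ min ((r : ℝ) * p ^ 2 * Real.log n / n ^ 2 + (r : ℝ) * p / n) 1 :=
    le_min (by positivity) zero_le_one
  have hcone := hsvd.nuclearNorm_le_of_le (D := D)
    (by rw [hD, add_sub_cancel]; exact hM.2 (mem_feasible_of_noise hA h1 h2)) r
  -- If the tail is small, `3√r F + 2t ≤ 5√r F`, which is where the `5` of the restricted lower
  -- bound comes from. If it is large, the bound holds with `W₂ = 1`.
  rcases le_total t (√r * F) with hcase | hcase
  · have hnuc : nuclearNorm D ≤ 5 * √r * F := by linarith
    have hDs : D.IsSymm := hM.1.1.sub hA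
    have hlow := h3 D hDs hnuc
    have hz : design β A + z - design β M = z - design β D := by
      rw [hD, design_sub]
      abel
    -- `A` and `M` both satisfy the `ℓ₁` constraint, so `(m/4) F ≤ 2nσ ≤ 6mσ`.
    have hb1 : F ≤ 24 * σ := by
      have e1 : ∑ i, |diffDesign β D i| ≤ 2 * n * σ := by
        refine (sum_abs_pairDiff_le _).trans ?_
        have e2 := hM.1.2.1
        rw [div_le_iff₀ (by linarith)] at e2 h1
        have e3 : ∑ i, |design β D i| ≤
            ∑ i, |z i| + ∑ i, |(design β A + z) i - design β M i| := by
          rw [← Finset.sum_add_distrib]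
          refine Finset.sum_le_sum fun i _ => ?_
          have e4 := congrFun hz i
          rw [Pi.sub_apply, Pi.sub_apply] at e4
          rw [e4]
          have e5 := abs_sub (z i) (z i - design β D i)
          rwa [sub_sub_cancel] at e5
        linarith
      have e6 : m / 4 * F ≤ 6 * m * σ := hlow.trans (e1.trans (by nlinarith))
      nlinarith
    -- `(m F / 4)² ≤ m ‖𝒳̃ D‖₂² ≤ m · 2η · 5√r F` gives `m F ≤ 160 √r η`, and `n ≤ 3m`. Squaring
    -- later produces `480² = 230400`.
    have hb2 : F ≤ 480 * √r * tuning n p σ / n := by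
      have hspec : specNorm (diffDual β (diffDesign β D)) ≤ 2 * tuning n p σ := by
        have e1 := hM.1.2.2
        rw [diffDesign, ← pairDiff_sub, hz, pairDiff_sub, diffDual_sub] at e1
        have e2 := specNorm_sub_le (diffDual β (pairDiff z))
          (diffDual β (pairDiff z) - diffDual β (pairDiff (design β D)))
        rw [sub_sub_cancel] at e2
        rw [diffDesign]
        linarith
      have hη : 0 ≤ tuning n p σ := by
        have : 0 ≤ specNorm (diffDual β (pairDiff z)) := norm_nonneg _
        linarith
      have hsq : ∑ i, diffDesign β D i ^ 2 ≤ 2 * tuning n p σ * (5 * √r * F) := by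
        have e1 := frobInner_le_nuclearNorm D (diffDual β (diffDesign β D))
        rw [frobInner_diffDual] at e1
        simp only [← sq] at e1
        refine e1.trans ?_
        rw [mul_comm]
        exact mul_le_mul hspec hnuc (nuclearNorm_nonneg _) (by positivity)
      have hcs : (∑ i, |diffDesign β D i|) ^ 2 ≤ m * ∑ i, diffDesign β D i ^ 2 := by
        have := sq_sum_le_card_mul_sum_sq (s := Finset.univ) (f := fun i => |diffDesign β D i|)
        simpa [sq_abs] using this
      have hmF : (m / 4 * F) ^ 2 ≤ m * (2 * tuning n p σ * (5 * √r * F)) :=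
        (pow_le_pow_left₀ (by positivity) hlow 2).trans
          (hcs.trans (mul_le_mul_of_nonneg_left hsq hm0.le))
      rcases hF0.eq_or_lt with hF | hF
      · rw [← hF]; positivity
      · have e1 : m * F * (m * F) ≤ m * F * (160 * √r * tuning n p σ) := by nlinarith
        have e2 := le_of_mul_le_mul_left e1 (by positivity)
        rw [le_div_iff₀ (by linarith)]
        nlinarith
    have hsq1 : F ^ 2 ≤ (230400 * 9216) * σ ^ 2 * 1 := by
      nlinarith [pow_le_pow_left₀ hF0 hb1 2, sq_nonneg σ]
    have hsq2 : F ^ 2 ≤ (230400 * 9216) * σ ^ 2 *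
        ((r : ℝ) * p ^ 2 * Real.log n / n ^ 2 + (r : ℝ) * p / n) := by
      refine (pow_le_pow_left₀ hF0 hb2 2).trans ?_
      rw [div_pow, mul_pow, mul_pow, hsqr]
      have e1 := tuning_sq_le (n := n) (p := p) (σ := σ) (by omega)
      have e2 : (480 : ℝ) ^ 2 * r * tuning n p σ ^ 2 / n ^ 2 ≤
          480 ^ 2 * r * (9216 * σ ^ 2 * (p * n + p ^ 2 * Real.log n)) / n ^ 2 := by
        gcongr
      refine e2.trans (le_of_eq ?_)
      field_simp
      ring
    have hnn : 0 ≤ t ^ 2 / r := by positivity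
    rcases min_choice ((r : ℝ) * p ^ 2 * Real.log n / n ^ 2 + (r : ℝ) * p / n) 1 with h | h <;>
      rw [h] <;> linarith
  · have h4 : F ^ 2 ≤ t ^ 2 / r := by
      rw [le_div_iff₀ (by linarith)]
      have := pow_le_pow_left₀ (by positivity) hcase 2
      rw [mul_pow, hsqr] at this
      linarith
    have : 0 ≤ (230400 * 9216) * σ ^ 2 *
        min ((r : ℝ) * p ^ 2 * Real.log n / n ^ 2 + (r : ℝ) * p / n) 1 := by positivity
    linarith

end Deterministic

/-! ### Nets of the sphere and the spectral norm -/

section Net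

open Metric Module in
/-- A `1/4`-separated set of unit vectors has at most `9 ^ dim` elements. -/
theorem card_le_of_quarter_separated {E : Type*} [NormedAddCommGroup E] [NormedSpace ℝ E]
    [FiniteDimensional ℝ E] (s : Finset E) (hs : ∀ c ∈ s, ‖c‖ = 1)
    (h : ∀ c ∈ s, ∀ d ∈ s, c ≠ d → 1 / 4 ≤ ‖c - d‖) : s.card ≤ 9 ^ finrank ℝ E := by
  borelize E
  let μ : Measure E := Measure.addHaar
  have hδ : (0 : ℝ) < 1 / 8 := by norm_num
  have hρ : (0 : ℝ) < 9 / 8 := by norm_num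
  -- Packing: disjoint balls of radius `1/8` inside one of radius `9/8`, so the volume ratio is `9 ^
  -- dim`.
  have hdisj : Set.Pairwise (s : Set E) (Function.onFun Disjoint fun c => ball c (1 / 8)) := by
    rintro c hc d hd hcd
    refine ball_disjoint_ball ?_
    rw [dist_eq_norm]
    exact le_trans (by norm_num) (h c hc d hd hcd)
  have hsub : (⋃ c ∈ s, ball c (1 / 8)) ⊆ ball (0 : E) (9 / 8) := by
    refine Set.iUnion₂_subset fun x hx => ball_subset_ball' ?_
    rw [dist_zero_right, hs x hx]
    norm_num
  have hvol : (s.card : ℝ≥0∞) * ENNReal.ofReal ((1 / 8) ^ finrank ℝ E) * μ (ball 0 1) ≤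
      ENNReal.ofReal ((9 / 8) ^ finrank ℝ E) * μ (ball 0 1) :=
    calc (s.card : ℝ≥0∞) * ENNReal.ofReal ((1 / 8) ^ finrank ℝ E) * μ (ball 0 1)
        = μ (⋃ c ∈ s, ball c (1 / 8)) := by
          rw [measure_biUnion_finset hdisj fun c _ => measurableSet_ball]
          simp only [μ.addHaar_ball_of_pos _ hδ, Finset.sum_const, nsmul_eq_mul, mul_assoc]
      _ ≤ μ (ball (0 : E) (9 / 8)) := measure_mono hsub
      _ = ENNReal.ofReal ((9 / 8) ^ finrank ℝ E) * μ (ball 0 1) := by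
          rw [μ.addHaar_ball_of_pos _ hρ]
  have hcard := (ENNReal.mul_le_mul_iff_left (measure_ball_pos _ _ zero_lt_one).ne'
    measure_ball_lt_top.ne).1 hvol
  have hreal : (s.card : ℝ) ≤ (9 : ℝ) ^ finrank ℝ E := by
    have := ENNReal.toReal_le_of_le_ofReal (by positivity) hcard
    simpa [div_eq_mul_inv, mul_pow] using this
  exact mod_cast hreal

/-- The unit sphere has a `1/4`-net with at most `9 ^ dim` elements. -/
theorem exists_quarter_net (E : Type*) [NormedAddCommGroup E] [NormedSpace ℝ E]
    [FiniteDimensional ℝ E] :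
    ∃ s : Finset E, s.card ≤ 9 ^ Module.finrank ℝ E ∧ (∀ c ∈ s, ‖c‖ = 1) ∧
      ∀ x : E, ‖x‖ = 1 → ∃ c ∈ s, ‖x - c‖ ≤ 1 / 4 := by
  classical
  let P : ℕ → Prop := fun k => ∃ s : Finset E, s.card = k ∧ (∀ c ∈ s, ‖c‖ = 1) ∧
    ∀ c ∈ s, ∀ d ∈ s, c ≠ d → 1 / 4 ≤ ‖c - d‖
  -- A separated set of largest cardinality, which exists by the packing bound, is a net: an
  -- uncovered unit vector could be added to it.
  have hP : P (Nat.findGreatest P (9 ^ Module.finrank ℝ E)) :=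
    Nat.findGreatest_spec (Nat.zero_le _) ⟨∅, by simp⟩
  obtain ⟨s, hs, h1, h2⟩ := hP
  refine ⟨s, card_le_of_quarter_separated s h1 h2, h1, fun x hx => ?_⟩
  by_contra! hcon
  have hxs : x ∉ s := fun hxs => by
    have := hcon x hxs
    simp at this
    linarith
  have h3 : P (s.card + 1) := by
    refine ⟨insert x s, Finset.card_insert_of_notMem hxs, ?_, ?_⟩
    · simpa [hx] using h1
    · intro c hc d hd hcd
      rcases Finset.mem_insert.1 hc with rfl | hc' <;> rcases Finset.mem_insert.1 hd with rfl | hd'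
      · exact absurd rfl hcd
      · exact (hcon d hd').le
      · rw [norm_sub_rev]
        exact (hcon c hc').le
      · exact h2 c hc' d hd' hcd
  obtain ⟨t, ht, ht1, ht2⟩ := h3
  have h4 := Nat.le_findGreatest (P := P) (ht ▸ card_le_of_quarter_separated t ht1 ht2)
    ⟨t, ht, ht1, ht2⟩
  omega

variable {p : ℕ}

/-- The quadratic form of a symmetric matrix on a `1/4`-net controls its spectral norm. -/
theorem exists_mem_net_specNorm_le (hp : 1 ≤ p) {s : Finset (EuclideanSpace ℝ (Fin p))}
    (h1 : ∀ c ∈ s, ‖c‖ = 1) (h2 : ∀ x : EuclideanSpace ℝ (Fin p), ‖x‖ = 1 →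
      ∃ c ∈ s, ‖x - c‖ ≤ 1 / 4) {S : Matrix (Fin p) (Fin p) ℝ} (hS : S.IsSymm) :
    ∃ c ∈ s, specNorm S ≤ 2 * |(c : Fin p → ℝ) ⬝ᵥ (S *ᵥ c)| := by
  have hsymm : ((toOp S : EuclideanSpace ℝ (Fin p) →L[ℝ] EuclideanSpace ℝ (Fin p)) :
      EuclideanSpace ℝ (Fin p) →ₗ[ℝ] EuclideanSpace ℝ (Fin p)).IsSymmetric := by
    rw [Matrix.coe_toEuclideanCLM_eq_toEuclideanLin, Matrix.isSymmetric_toEuclideanLin_iff,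
      Matrix.IsHermitian, Matrix.conjTranspose_eq_transpose_of_trivial]
    exact hS
  have hne : s.Nonempty := by
    obtain ⟨c, hc, -⟩ := h2 (EuclideanSpace.single ⟨0, hp⟩ 1) (by simp)
    exact ⟨c, hc⟩
  obtain ⟨c, hc, hmax⟩ := s.exists_max_image
    (fun c => |(c : Fin p → ℝ) ⬝ᵥ (S *ᵥ c)|) hne
  refine ⟨c, hc, ?_⟩
  set K := |(c : Fin p → ℝ) ⬝ᵥ (S *ᵥ c)| with hK
  have hT0 : 0 ≤ specNorm S := norm_nonneg _
  -- Moving each argument of the form to the net costs a quarter of the spectral norm. By symmetry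
  -- that norm is the supremum of the Rayleigh quotients, so half of it is absorbed.
  have key : ∀ x : EuclideanSpace ℝ (Fin p), ‖x‖ = 1 → |⟪x, toOp S x⟫| ≤ K + specNorm S / 2 := by
    intro x hx
    obtain ⟨d, hd, hxd⟩ := h2 x hx
    have e1 : ⟪x, toOp S x⟫ = ⟪d, toOp S d⟫ + ⟪x - d, toOp S x⟫ + ⟪d, toOp S (x - d)⟫ := by
      rw [map_sub, inner_sub_left, inner_sub_right]
      ring
    have e2 : |⟪d, toOp S d⟫| ≤ K := by
      rw [Matrix.inner_toEuclideanCLM]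
      exact hmax d hd
    have e3 : |⟪x - d, toOp S x⟫| ≤ specNorm S / 4 := by
      refine (abs_real_inner_le_norm _ _).trans ?_
      have := norm_toOp_le S x
      rw [hx, mul_one] at this
      nlinarith [norm_nonneg (x - d), norm_nonneg (toOp S x)]
    have e4 : |⟪d, toOp S (x - d)⟫| ≤ specNorm S / 4 := by
      refine (abs_real_inner_le_norm _ _).trans ?_
      rw [h1 d hd, one_mul]
      have := norm_toOp_le S (x - d)
      nlinarith
    rw [e1]
    refine (abs_add_three _ _ _).trans ?_
    linarith
  have hle : specNorm S ≤ K + specNorm S / 2 := by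
    conv_lhs => rw [specNorm, ContinuousLinearMap.norm_eq_iSup_rayleighQuotient _ hsymm]
    refine ciSup_le fun x => ?_
    rcases eq_or_ne x 0 with rfl | hx
    · simp
      positivity
    · have hx' : ‖x‖ ≠ 0 := norm_ne_zero_iff.2 hx
      rw [← ContinuousLinearMap.rayleigh_smul _ x (inv_ne_zero hx'),
        ContinuousLinearMap.rayleighQuotient, ContinuousLinearMap.reApplyInnerSelf_apply]
      have hu : ‖(‖x‖⁻¹ : ℝ) • x‖ = 1 := by
        rw [norm_smul, norm_inv, norm_norm, inv_mul_cancel₀ hx']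
      rw [hu, one_pow, div_one, real_inner_comm]
      exact key _ hu
  linarith

end Net

/-! ### Exponential moments of weighted sums of rank-two differences -/

section GaussianMGF

/-- The law of a standard Gaussian vector. -/
noncomputable abbrev gaussVec (p : ℕ) : Measure (Fin p → ℝ) :=
  Measure.pi fun _ => gaussianReal 0 1

/-- The law of a pair of independent standard Gaussian vectors. -/
noncomputable abbrev gaussPair (p : ℕ) : Measure ((Fin p → ℝ) × (Fin p → ℝ)) :=
  (gaussVec p).prod (gaussVec p)

/-- The law of `m` independent pairs of standard Gaussian vectors. -/
noncomputable abbrev gaussPairs (m p : ℕ) : Measure (Fin m → (Fin p → ℝ) × (Fin p → ℝ)) :=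
  Measure.pi fun _ => gaussPair p

theorem lintegral_pi_prod {ι : Type*} [Fintype ι] {X : ι → Type*} [∀ i, MeasurableSpace (X i)]
    (μ : ∀ i, Measure (X i)) [∀ i, IsProbabilityMeasure (μ i)] (f : ∀ i, X i → ℝ≥0∞)
    (hf : ∀ i, Measurable (f i)) :
    ∫⁻ x, ∏ i, f i (x i) ∂Measure.pi μ = ∏ i, ∫⁻ x, f i x ∂μ i := by
  have h := lintegral_prod_eq_prod_lintegral_of_indepFun Finset.univ
    (fun i (x : ∀ i, X i) => f i (x i)) (iIndepFun_pi (μ := μ) fun i => (hf i).aemeasurable)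
    (fun i => (hf i).comp (measurable_pi_apply i))
  rw [h]
  exact Finset.prod_congr rfl fun i _ => (measurePreserving_eval μ i).lintegral_comp (hf i)

/-- The moment generating function of the square of a standard Gaussian variable. -/
theorem lintegral_exp_mul_sq_gaussianReal {t : ℝ} (ht : t < 1 / 2) :
    ∫⁻ x, ENNReal.ofReal (Real.exp (t * x ^ 2)) ∂gaussianReal 0 1 =
      ENNReal.ofReal (√(1 - 2 * t))⁻¹ := by
  rw [gaussianReal_of_var_ne_zero 0 one_ne_zero, lintegral_withDensity_eq_lintegral_mul _
    (measurable_gaussianPDF 0 1) (by fun_prop)]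
  have h1 : ∀ x : ℝ, (gaussianPDF 0 1 * fun x => ENNReal.ofReal (Real.exp (t * x ^ 2))) x =
      ENNReal.ofReal ((√(2 * Real.pi))⁻¹ * Real.exp (-(1 / 2 - t) * x ^ 2)) := by
    intro x
    rw [Pi.mul_apply, gaussianPDF, ← ENNReal.ofReal_mul (gaussianPDFReal_nonneg _ _ _),
      gaussianPDFReal]
    congr 1
    rw [mul_assoc, ← Real.exp_add]
    simp only [NNReal.coe_one, sub_zero, mul_one]
    congr 2
    ring
  simp_rw [h1]
  rw [← ofReal_integral_eq_lintegral_ofReal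
    ((integrable_exp_neg_mul_sq (by linarith)).const_mul _)
    (Filter.Eventually.of_forall fun x => by positivity), integral_const_mul, integral_gaussian,
    ← Real.sqrt_inv, ← Real.sqrt_mul (by positivity), ← Real.sqrt_inv]
  congr 2
  have := Real.pi_pos
  have h2 : 1 - 2 * t ≠ 0 := by linarith
  have h3 : 1 / 2 - t ≠ 0 := by linarith
  field_simp

theorem hasLaw_dotProduct_gaussVec {p : ℕ} {x : EuclideanSpace ℝ (Fin p)} (hx : ‖x‖ = 1) :
    HasLaw (fun β : Fin p → ℝ => (x : Fin p → ℝ) ⬝ᵥ β) (gaussianReal 0 1) (gaussVec p) := by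
  have hmeas : Measurable fun β : Fin p → ℝ => (x : Fin p → ℝ) ⬝ᵥ β := by
    unfold dotProduct
    fun_prop
  refine ⟨hmeas.aemeasurable, ?_⟩
  have h1 := IsGaussian.map_eq_gaussianReal (μ := stdGaussian (EuclideanSpace ℝ (Fin p)))
    (innerSL ℝ x)
  rw [integral_strongDual_stdGaussian, variance_dual_stdGaussian, innerSL_apply_norm, hx,
    ← map_pi_eq_stdGaussian, Measure.map_map (by fun_prop) (by fun_prop)] at h1
  convert h1 using 2
  · ext β
    simp [PiLp.inner_apply, dotProduct, mul_comm]
  · simp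

/-- The moment generating function of the difference of two independent chi-square variables. -/
theorem lintegral_exp_sq_sub_sq_le {p : ℕ} {x : EuclideanSpace ℝ (Fin p)} (hx : ‖x‖ = 1)
    {t : ℝ} (ht : 4 * t ^ 2 ≤ 3 / 4) :
    ∫⁻ b, ENNReal.ofReal (Real.exp (t * (((x : Fin p → ℝ) ⬝ᵥ b.1) ^ 2 -
      ((x : Fin p → ℝ) ⬝ᵥ b.2) ^ 2))) ∂gaussPair p ≤ ENNReal.ofReal (Real.exp (4 * t ^ 2)) := by
  have hlaw := hasLaw_dotProduct_gaussVec hx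
  have habs : |t| < 1 / 2 := by
    rw [← sq_lt_sq₀ (abs_nonneg t) (by norm_num), sq_abs]
    linarith
  obtain ⟨ht1, ht2⟩ := abs_lt.1 habs
  have hmeas : Measurable fun β : Fin p → ℝ => (x : Fin p → ℝ) ⬝ᵥ β := by
    unfold dotProduct
    fun_prop
  have hone : ∀ s : ℝ, s < 1 / 2 →
      ∫⁻ β, ENNReal.ofReal (Real.exp (s * ((x : Fin p → ℝ) ⬝ᵥ β) ^ 2)) ∂gaussVec p =
        ENNReal.ofReal (√(1 - 2 * s))⁻¹ := fun s hs => by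
    rw [← lintegral_exp_mul_sq_gaussianReal hs]
    exact hlaw.lintegral_comp
      (f := fun y => ENNReal.ofReal (Real.exp (s * y ^ 2))) (by fun_prop)
  have hsplit : ∀ b : (Fin p → ℝ) × (Fin p → ℝ),
      ENNReal.ofReal (Real.exp (t * (((x : Fin p → ℝ) ⬝ᵥ b.1) ^ 2 -
        ((x : Fin p → ℝ) ⬝ᵥ b.2) ^ 2))) =
      ENNReal.ofReal (Real.exp (t * ((x : Fin p → ℝ) ⬝ᵥ b.1) ^ 2)) *
        ENNReal.ofReal (Real.exp (-t * ((x : Fin p → ℝ) ⬝ᵥ b.2) ^ 2)) := fun b => by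
    rw [← ENNReal.ofReal_mul (Real.exp_nonneg _), ← Real.exp_add]
    congr 2
    ring
  simp_rw [hsplit]
  rw [lintegral_prod_mul (f := fun β => ENNReal.ofReal (Real.exp (t * ((x : Fin p → ℝ) ⬝ᵥ β) ^ 2)))
    (g := fun β => ENNReal.ofReal (Real.exp (-t * ((x : Fin p → ℝ) ⬝ᵥ β) ^ 2)))
    (by fun_prop) (by fun_prop), hone t ht2, hone (-t) (by linarith),
    ← ENNReal.ofReal_mul (by positivity)]
  refine ENNReal.ofReal_le_ofReal ?_
  rw [← mul_inv, ← Real.sqrt_mul (by linarith)]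
  -- `1 - y ≥ exp (-2 y)` on `[0, 3/4]`
  set y := 4 * t ^ 2 with hy
  have hy0 : 0 ≤ y := by positivity
  have hexp : Real.exp (-(2 * y)) ≤ 1 - y := by
    -- The chord of `exp` from `-3/2` to `0` lies below `1 - y` at `-2y`, because `exp (-3/2) ≤
    -- 1/4`.
    have hc := convexOn_exp.2 (Set.mem_univ (0 : ℝ)) (Set.mem_univ (-(3 / 2) : ℝ))
      (by linarith : (0 : ℝ) ≤ 1 - 4 / 3 * y) (by positivity : (0 : ℝ) ≤ 4 / 3 * y) (by ring)
    have e1 : Real.exp (-(3 / 2)) ≤ 1 / 4 := by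
      rw [Real.exp_neg, inv_le_comm₀ (Real.exp_pos _) (by norm_num)]
      have e2 := Real.quadratic_le_exp_of_nonneg (x := 3 / 4) (by norm_num)
      have e3 : Real.exp (3 / 2) = Real.exp (3 / 4) ^ 2 := by
        rw [← Real.exp_nat_mul]
        norm_num
      rw [e3]
      nlinarith
    simp only [smul_eq_mul, mul_zero, zero_add, Real.exp_zero, mul_one] at hc
    have e4 : 4 / 3 * y * -(3 / 2) = -(2 * y) := by ring
    rw [e4] at hc
    nlinarith
  have h1 : (1 - 2 * t) * (1 - 2 * -t) = 1 - y := by rw [hy]; ring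
  rw [h1, inv_le_comm₀ (Real.sqrt_pos.2 (by linarith)) (Real.exp_pos _), ← Real.exp_neg]
  refine Real.le_sqrt_of_sq_le ?_
  rw [← Real.exp_nat_mul]
  refine le_trans (le_of_eq ?_) hexp
  congr 1
  push_cast
  ring

/-- The difference of the outer squares of two vectors. -/
def pairMat {p : ℕ} (b : (Fin p → ℝ) × (Fin p → ℝ)) : Matrix (Fin p) (Fin p) ℝ :=
  Matrix.vecMulVec b.1 b.1 - Matrix.vecMulVec b.2 b.2

theorem pairMat_isSymm {p : ℕ} (b : (Fin p → ℝ) × (Fin p → ℝ)) : (pairMat b).IsSymm := by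
  ext i j
  simp [pairMat, Matrix.vecMulVec_apply, mul_comm]

theorem measurable_pairMat_apply {p : ℕ} (i j : Fin p) :
    Measurable fun b : (Fin p → ℝ) × (Fin p → ℝ) => pairMat b i j := by
  simp only [pairMat, Matrix.sub_apply, Matrix.vecMulVec_apply]
  fun_prop

theorem dotProduct_pairMat {p : ℕ} (b : (Fin p → ℝ) × (Fin p → ℝ)) (x : Fin p → ℝ) :
    x ⬝ᵥ (pairMat b *ᵥ x) = (x ⬝ᵥ b.1) ^ 2 - (x ⬝ᵥ b.2) ^ 2 := by
  simp only [pairMat, Matrix.sub_mulVec, dotProduct_sub, Matrix.vecMulVec_mulVec]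
  simp [dotProduct_comm, sq]

/-- The exponential moment of the spectral norm of a weighted sum of differences of outer
squares. -/
theorem lintegral_exp_specNorm_le {m p : ℕ} (hp : 1 ≤ p) (w : Fin m → ℝ) {s : ℝ} (hs : 0 ≤ s)
    (hw : ∀ i, 4 * (s * w i) ^ 2 ≤ 3 / 4) :
    ∫⁻ b, ENNReal.ofReal (Real.exp (s * (specNorm (∑ i, w i • pairMat (b i)) / 2)))
      ∂gaussPairs m p ≤
    ENNReal.ofReal (2 * 9 ^ p * Real.exp (4 * s ^ 2 * ∑ i, w i ^ 2)) := by
  obtain ⟨N, hcard, hN1, hN2⟩ := exists_quarter_net (EuclideanSpace ℝ (Fin p))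
  rw [finrank_euclideanSpace_fin] at hcard
  let q : EuclideanSpace ℝ (Fin p) → (Fin p → ℝ) × (Fin p → ℝ) → ℝ := fun x b =>
    ((x : Fin p → ℝ) ⬝ᵥ b.1) ^ 2 - ((x : Fin p → ℝ) ⬝ᵥ b.2) ^ 2
  have hq : ∀ x, Measurable (q x) := fun x => by
    simp only [q, dotProduct]
    fun_prop
  have hform : ∀ (x : EuclideanSpace ℝ (Fin p)) (b : Fin m → (Fin p → ℝ) × (Fin p → ℝ)),
      (x : Fin p → ℝ) ⬝ᵥ ((∑ i, w i • pairMat (b i)) *ᵥ x) = ∑ i, w i * q x (b i) := by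
    intro x b
    rw [Matrix.sum_mulVec, dotProduct_sum]
    refine Finset.sum_congr rfl fun i _ => ?_
    rw [Matrix.smul_mulVec, dotProduct_smul, dotProduct_pairMat, smul_eq_mul]
  let g : ℝ → EuclideanSpace ℝ (Fin p) → (Fin m → (Fin p → ℝ) × (Fin p → ℝ)) → ℝ≥0∞ :=
    fun e x b => ∏ i, ENNReal.ofReal (Real.exp (e * s * w i * q x (b i)))
  have hg : ∀ e x b, g e x b = ENNReal.ofReal (Real.exp (e * s * ∑ i, w i * q x (b i))) := by
    intro e x b
    simp only [g]
    rw [← ENNReal.ofReal_prod_of_nonneg fun _ _ => (Real.exp_nonneg _), ← Real.exp_sum,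
      Finset.mul_sum]
    simp only [mul_assoc]
  -- The maximum over the net and over both signs is bounded by the sum, whence the factor `2 * 9 ^
  -- p`.
  have hpt : ∀ b, ENNReal.ofReal (Real.exp (s * (specNorm (∑ i, w i • pairMat (b i)) / 2))) ≤
      ∑ x ∈ N, (g 1 x b + g (-1) x b) := by
    intro b
    have hsymm : (∑ i, w i • pairMat (b i)).IsSymm := by
      rw [Matrix.IsSymm, Matrix.transpose_sum]
      exact Finset.sum_congr rfl fun i _ => by
        rw [Matrix.transpose_smul, (pairMat_isSymm (b i)).eq]
    obtain ⟨x, hx, hle⟩ := exists_mem_net_specNorm_le hp hN1 hN2 hsymm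
    rw [hform] at hle
    refine le_trans ?_ (Finset.single_le_sum (f := fun x => g 1 x b + g (-1) x b)
      (fun _ _ => zero_le) hx)
    simp only [hg]
    rcases abs_cases (∑ i, w i * q x (b i)) with ⟨h, -⟩ | ⟨h, -⟩
    · refine le_trans (ENNReal.ofReal_le_ofReal (Real.exp_le_exp.2 ?_)) le_self_add
      rw [one_mul]
      exact mul_le_mul_of_nonneg_left (by linarith) hs
    · refine le_trans (ENNReal.ofReal_le_ofReal (Real.exp_le_exp.2 ?_)) le_add_self
      rw [neg_one_mul, neg_mul, ← mul_neg]
      exact mul_le_mul_of_nonneg_left (by linarith) hs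
  have hgm : ∀ e x, Measurable (g e x) := fun e x => by
    refine Finset.measurable_prod _ fun i _ => ?_
    have := (hq x).comp (measurable_pi_apply (X := fun _ : Fin m => (Fin p → ℝ) × (Fin p → ℝ)) i)
    simp only [Function.comp_def] at this
    fun_prop
  have hgint : ∀ e x, e ^ 2 = 1 → x ∈ N → ∫⁻ b, g e x b ∂gaussPairs m p ≤
      ENNReal.ofReal (Real.exp (4 * s ^ 2 * ∑ i, w i ^ 2)) := by
    intro e x he hx
    have h1 : ∫⁻ b, g e x b ∂gaussPairs m p =
        ∏ i, ∫⁻ b, ENNReal.ofReal (Real.exp (e * s * w i * q x b)) ∂gaussPair p :=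
      lintegral_pi_prod (fun _ => gaussPair p)
        (fun i b => ENNReal.ofReal (Real.exp (e * s * w i * q x b))) fun i => by
          have := hq x
          fun_prop
    rw [h1, Finset.mul_sum, Real.exp_sum, ENNReal.ofReal_prod_of_nonneg fun _ _ => by positivity]
    refine Finset.prod_le_prod' fun i _ => ?_
    have h2 : (e * s * w i) ^ 2 = (s * w i) ^ 2 := by
      rw [mul_assoc, mul_pow, he, one_mul]
    refine (lintegral_exp_sq_sub_sq_le (hN1 x hx) (by rw [h2]; exact hw i)).trans (le_of_eq ?_)
    rw [h2, mul_pow, mul_assoc]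
  calc _ ≤ ∫⁻ b, ∑ x ∈ N, (g 1 x b + g (-1) x b) ∂gaussPairs m p := lintegral_mono hpt
    _ = ∑ x ∈ N, (∫⁻ b, g 1 x b ∂gaussPairs m p + ∫⁻ b, g (-1) x b ∂gaussPairs m p) := by
        rw [lintegral_finsetSum (f := fun x b => g 1 x b + g (-1) x b) _
          fun x _ => (hgm 1 x).add (hgm (-1) x)]
        exact Finset.sum_congr rfl fun x _ => lintegral_add_left (hgm 1 x) _
    _ ≤ ∑ _x ∈ N, 2 * ENNReal.ofReal (Real.exp (4 * s ^ 2 * ∑ i, w i ^ 2)) := by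
        refine Finset.sum_le_sum fun x hx => ?_
        rw [two_mul]
        exact add_le_add (hgint 1 x (by norm_num) hx) (hgint (-1) x (by norm_num) hx)
    _ = N.card * (2 * ENNReal.ofReal (Real.exp (4 * s ^ 2 * ∑ i, w i ^ 2))) := by
        rw [Finset.sum_const, nsmul_eq_mul]
    _ ≤ 9 ^ p * (2 * ENNReal.ofReal (Real.exp (4 * s ^ 2 * ∑ i, w i ^ 2))) := by
        gcongr
        exact_mod_cast hcard
    _ = ENNReal.ofReal (2 * 9 ^ p * Real.exp (4 * s ^ 2 * ∑ i, w i ^ 2)) := by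
        rw [ENNReal.ofReal_mul (by positivity), ENNReal.ofReal_mul (by norm_num),
          ENNReal.ofReal_pow (by norm_num), ENNReal.ofReal_ofNat, ENNReal.ofReal_ofNat]
        ring

end GaussianMGF

/-! ### Symmetrization for suprema of exponentials -/

section Contraction

variable {X T : Type*} [MeasurableSpace X] [Countable T]

/-- Iterating over independent coordinates a comparison of weighted suprema. -/
theorem lintegral_iSup_prod_le {μ : Measure X} [IsProbabilityMeasure μ] {f g : T → X → ℝ≥0∞}
    (hf : ∀ t, Measurable (f t)) (hg : ∀ t, Measurable (g t))
    (h : ∀ a : T → ℝ≥0∞, ∫⁻ x, ⨆ t, a t * f t x ∂μ ≤ ∫⁻ x, ⨆ t, a t * g t x ∂μ)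
    (m : ℕ) (a : T → ℝ≥0∞) :
    ∫⁻ x, ⨆ t, a t * ∏ i, f t (x i) ∂Measure.pi (fun _ : Fin m => μ) ≤
      ∫⁻ x, ⨆ t, a t * ∏ i, g t (x i) ∂Measure.pi (fun _ : Fin m => μ) := by
  -- The weights are arbitrary so that they can absorb the factors of the coordinates held fixed:
  -- the other coordinates are exchanged first, then the remaining one by Tonelli.
  induction m generalizing a with
  | zero => simp
  | succ m ih =>
    have hsplit : ∀ k : T → X → ℝ≥0∞, (∀ t, Measurable (k t)) →
        ∫⁻ x, ⨆ t, a t * ∏ i, k t (x i) ∂Measure.pi (fun _ : Fin (m + 1) => μ) =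
          ∫⁻ z, ⨆ t, a t * (k t z.1 * ∏ i, k t (z.2 i))
            ∂μ.prod (Measure.pi (fun _ : Fin m => μ)) := by
      intro k hk
      have hmp := measurePreserving_piFinSuccAbove (fun _ : Fin (m + 1) => μ) 0
      rw [← hmp.lintegral_comp_emb (MeasurableEquiv.measurableEmbedding _)]
      refine lintegral_congr fun x => ?_
      refine iSup_congr fun t => ?_
      rw [Fin.prod_univ_succAbove _ 0]
      rfl
    have hprod : ∀ k : T → X → ℝ≥0∞, (∀ t, Measurable (k t)) → ∀ t,
        Measurable fun y : Fin m → X => ∏ i, k t (y i) := fun k hk t =>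
      Finset.measurable_prod _ fun i _ => (hk t).comp (measurable_pi_apply i)
    have hmeas : ∀ k l : T → X → ℝ≥0∞, (∀ t, Measurable (k t)) → (∀ t, Measurable (l t)) →
        Measurable fun z : X × (Fin m → X) => ⨆ t, a t * (k t z.1 * ∏ i, l t (z.2 i)) :=
      fun k l hk hl => Measurable.iSup fun t => measurable_const.mul
        (((hk t).comp measurable_fst).mul ((hprod l hl t).comp measurable_snd))
    rw [hsplit f hf, hsplit g hg]
    calc ∫⁻ z, ⨆ t, a t * (f t z.1 * ∏ i, f t (z.2 i)) ∂μ.prod (Measure.pi fun _ : Fin m => μ)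
        = ∫⁻ x, ∫⁻ y, ⨆ t, (a t * f t x) * ∏ i, f t (y i) ∂Measure.pi (fun _ : Fin m => μ) ∂μ := by
          rw [lintegral_prod _ (hmeas f f hf hf).aemeasurable]
          simp only [mul_assoc]
      _ ≤ ∫⁻ x, ∫⁻ y, ⨆ t, (a t * f t x) * ∏ i, g t (y i) ∂Measure.pi (fun _ : Fin m => μ) ∂μ :=
          lintegral_mono fun x => ih _
      _ = ∫⁻ y, ∫⁻ x, ⨆ t, (a t * ∏ i, g t (y i)) * f t x ∂μ ∂Measure.pi (fun _ : Fin m => μ) := by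
          rw [lintegral_lintegral_swap]
          · simp only [mul_assoc, mul_comm]
          · have := hmeas f g hf hg
            simp only [← mul_assoc] at this
            exact this.aemeasurable
      _ ≤ ∫⁻ y, ∫⁻ x, ⨆ t, (a t * ∏ i, g t (y i)) * g t x ∂μ ∂Measure.pi (fun _ : Fin m => μ) :=
          lintegral_mono fun y => h _
      _ = ∫⁻ z, ⨆ t, a t * (g t z.1 * ∏ i, g t (z.2 i)) ∂μ.prod (Measure.pi fun _ : Fin m => μ) := by
          rw [lintegral_prod_symm _ (hmeas g g hg hg).aemeasurable]
          simp only [mul_comm, mul_left_comm]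

/-- A one-variable symmetrization and contraction inequality for weighted suprema of
exponentials. -/
theorem lintegral_iSup_exp_le {μ : Measure X} {Y : T → X → ℝ} (hY : ∀ t, Measurable (Y t))
    {ρ : X → X} (hρ : MeasurePreserving ρ μ μ) (hodd : ∀ t x, Y t (ρ x) = -Y t x)
    {c l : ℝ} (hl : 0 ≤ l) (hc : ∀ t, ENNReal.ofReal (Real.exp (2 * l * c)) ≤
      ∫⁻ x, ENNReal.ofReal (Real.exp (2 * l * |Y t x|)) ∂μ) [IsProbabilityMeasure μ]
    (a : T → ℝ≥0∞) :
    ∫⁻ x, ⨆ t, a t * ENNReal.ofReal (Real.exp (l * (c - |Y t x|))) ∂μ ≤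
      ∫⁻ x, ⨆ t, a t * ENNReal.ofReal (Real.exp (2 * l * Y t x)) ∂μ := by
  let F : (T → X → ℝ) → X → ℝ≥0∞ := fun y x => ⨆ t, a t * ENNReal.ofReal (Real.exp (2 * l * y t x))
  have hF : ∀ y, (∀ t, Measurable (y t)) → Measurable (F y) := fun y hy =>
    Measurable.iSup fun t => measurable_const.mul
      (ENNReal.measurable_ofReal.comp (Real.measurable_exp.comp ((hy t).const_mul _)))
  have habs : ∀ t, Measurable fun x => |Y t x| := fun t => (hY t).abs
  -- The arithmetic-geometric mean inequality splits `exp(lc) · exp(-l|Y|)` into a constant and a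
  -- term in `-|Y|`, at the price of doubling `l`.
  have hpt : ∀ x, ⨆ t, a t * ENNReal.ofReal (Real.exp (l * (c - |Y t x|))) ≤
      2⁻¹ * ((⨆ t, a t * ENNReal.ofReal (Real.exp (2 * l * c))) + F (fun t x => -|Y t x|) x) := by
    intro x
    refine iSup_le fun t => ?_
    have h1 : Real.exp (l * (c - |Y t x|)) ≤
        2⁻¹ * (Real.exp (2 * l * c) + Real.exp (2 * l * -|Y t x|)) := by
      have e1 : Real.exp (2 * l * c) = Real.exp (l * c) ^ 2 := by
        rw [← Real.exp_nat_mul]; congr 1; push_cast; ring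
      have e2 : Real.exp (2 * l * -|Y t x|) = Real.exp (-(l * |Y t x|)) ^ 2 := by
        rw [← Real.exp_nat_mul]; congr 1; push_cast; ring
      rw [e1, e2, mul_sub, sub_eq_add_neg, Real.exp_add]
      nlinarith [sq_nonneg (Real.exp (l * c) - Real.exp (-(l * |Y t x|)))]
    calc a t * ENNReal.ofReal (Real.exp (l * (c - |Y t x|)))
        ≤ a t * ENNReal.ofReal (2⁻¹ * (Real.exp (2 * l * c) + Real.exp (2 * l * -|Y t x|))) := by
          gcongr
      _ = 2⁻¹ * (a t * ENNReal.ofReal (Real.exp (2 * l * c)) +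
            a t * ENNReal.ofReal (Real.exp (2 * l * -|Y t x|))) := by
          rw [ENNReal.ofReal_mul (by norm_num), ENNReal.ofReal_add (by positivity) (by positivity),
            ENNReal.ofReal_inv_of_pos (by norm_num), ENNReal.ofReal_ofNat]
          ring
      _ ≤ _ := by
          gcongr
          · exact le_iSup (fun t => a t * ENNReal.ofReal (Real.exp (2 * l * c))) t
          · exact le_iSup (fun t => a t * ENNReal.ofReal (Real.exp (2 * l * -|Y t x|))) t
  -- The moment hypothesis replaces the constant by a supremum in `+|Y|`. The pair `±|Y|` is then
  -- traded for the pair `±Y`, whose two members have equal integrals by the symmetry `ρ`.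
  have hconst : ⨆ t, a t * ENNReal.ofReal (Real.exp (2 * l * c)) ≤
      ∫⁻ x, F (fun t x => |Y t x|) x ∂μ := by
    refine iSup_le fun t => ?_
    calc a t * ENNReal.ofReal (Real.exp (2 * l * c))
        ≤ a t * ∫⁻ x, ENNReal.ofReal (Real.exp (2 * l * |Y t x|)) ∂μ := by
          gcongr
          exact hc t
      _ ≤ ∫⁻ x, a t * ENNReal.ofReal (Real.exp (2 * l * |Y t x|)) ∂μ := lintegral_const_mul_le _ _
      _ ≤ _ := lintegral_mono fun x =>
          le_iSup (fun t => a t * ENNReal.ofReal (Real.exp (2 * l * |Y t x|))) t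
  -- pointwise, the larger and the smaller of two suprema
  have htwo : ∀ x, F (fun t x => |Y t x|) x + F (fun t x => -|Y t x|) x ≤
      F Y x + F (fun t x => -Y t x) x := by
    intro x
    have hmono : ∀ t, ∀ y y' : ℝ, y ≤ y' → a t * ENNReal.ofReal (Real.exp (2 * l * y)) ≤
        a t * ENNReal.ofReal (Real.exp (2 * l * y')) := fun t y y' hyy => by gcongr
    have e1 : F (fun t x => |Y t x|) x ≤ max (F Y x) (F (fun t x => -Y t x) x) := by
      refine iSup_le fun t => ?_
      beta_reduce
      rcases abs_choice (Y t x) with h | h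
      · rw [h]
        exact le_max_of_le_left (le_iSup (fun t => a t * ENNReal.ofReal
          (Real.exp (2 * l * Y t x))) t)
      · rw [h]
        exact le_max_of_le_right (le_iSup (fun t => a t * ENNReal.ofReal
          (Real.exp (2 * l * -Y t x))) t)
    have e2 : F (fun t x => -|Y t x|) x ≤ min (F Y x) (F (fun t x => -Y t x) x) :=
      le_min (iSup_mono fun t => hmono t _ _ (neg_abs_le _))
        (iSup_mono fun t => hmono t _ _ (neg_le_neg (le_abs_self _)))
    exact (add_le_add e1 e2).trans (max_add_min _ _).le
  have hsymm : ∫⁻ x, F (fun t x => -Y t x) x ∂μ = ∫⁻ x, F Y x ∂μ := by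
    rw [← hρ.lintegral_comp (hF Y hY)]
    simp only [F, hodd]
  calc ∫⁻ x, ⨆ t, a t * ENNReal.ofReal (Real.exp (l * (c - |Y t x|))) ∂μ
      ≤ ∫⁻ x, 2⁻¹ * ((⨆ t, a t * ENNReal.ofReal (Real.exp (2 * l * c))) +
          F (fun t x => -|Y t x|) x) ∂μ := lintegral_mono hpt
    _ = 2⁻¹ * ((⨆ t, a t * ENNReal.ofReal (Real.exp (2 * l * c))) +
          ∫⁻ x, F (fun t x => -|Y t x|) x ∂μ) := by
        rw [lintegral_const_mul' _ _ (by simp), lintegral_add_left measurable_const]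
        simp
    _ ≤ 2⁻¹ * (∫⁻ x, F (fun t x => |Y t x|) x ∂μ + ∫⁻ x, F (fun t x => -|Y t x|) x ∂μ) := by
        gcongr
    _ = 2⁻¹ * ∫⁻ x, (F (fun t x => |Y t x|) x + F (fun t x => -|Y t x|) x) ∂μ := by
        rw [lintegral_add_left (hF _ habs)]
    _ ≤ 2⁻¹ * ∫⁻ x, (F Y x + F (fun t x => -Y t x) x) ∂μ := by
        exact mul_le_mul_right (lintegral_mono htwo) _
    _ = ∫⁻ x, F Y x ∂μ := by
        rw [lintegral_add_left (hF Y hY), hsymm, ← two_mul, ← mul_assoc,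
          ENNReal.inv_mul_cancel (by norm_num) (by norm_num), one_mul]

end Contraction

/-! ### A lower bound for the size of one differenced measurement -/

section SmallBall

/-- The chi-square characteristic function `(1 - 2il)^(-1/2)`. Squaring it avoids a branch of the
complex square root. -/
theorem norm_integral_cexp_mul_sq_gaussianReal (l : ℝ) :
    ‖∫ x : ℝ, Complex.exp (Complex.I * (l * x ^ 2 : ℝ)) ∂gaussianReal 0 1‖ ^ 2 =
      (√(1 + 4 * l ^ 2))⁻¹ := by
  rw [integral_gaussianReal_eq_integral_smul one_ne_zero]
  have h1 : ∀ x : ℝ, gaussianPDFReal 0 1 x • Complex.exp (Complex.I * (l * x ^ 2 : ℝ)) =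
      ((√(2 * Real.pi))⁻¹ : ℝ) * Complex.exp (-(1 / 2 - Complex.I * l) * (x : ℂ) ^ 2) := by
    intro x
    rw [gaussianPDFReal, Complex.real_smul, Complex.ofReal_mul, mul_assoc, Complex.ofReal_exp,
      ← Complex.exp_add]
    simp only [NNReal.coe_one, sub_zero, mul_one]
    congr 2
    push_cast
    ring
  simp_rw [h1]
  rw [integral_const_mul, ← norm_pow, mul_pow, integral_gaussian_sq_complex (by simp), norm_mul,
    norm_div, norm_pow, Complex.norm_real, Complex.norm_real, Real.norm_eq_abs, Real.norm_eq_abs,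
    sq_abs, inv_pow, Real.sq_sqrt (by positivity), abs_of_pos Real.pi_pos]
  have h2 : ‖(1 / 2 - Complex.I * l : ℂ)‖ = √(1 + 4 * l ^ 2) / 2 := by
    have h3 : (1 / 2 - Complex.I * l : ℂ) = ((1 / 2 : ℝ) : ℂ) + ((-l : ℝ) : ℂ) * Complex.I := by
      push_cast
      ring
    rw [h3, Complex.norm_add_mul_I]
    have h4 : (1 / 2 : ℝ) ^ 2 + (-l) ^ 2 = (1 + 4 * l ^ 2) / 2 ^ 2 := by ring
    rw [h4, Real.sqrt_div (by positivity), Real.sqrt_sq (by norm_num)]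
  rw [h2]
  have := Real.pi_pos
  have h5 : √(1 + 4 * l ^ 2) ≠ 0 := (Real.sqrt_pos.2 (by positivity)).ne'
  field_simp

theorem one_add_sum_le_prod_one_add {ι : Type*} (s : Finset ι) (f : ι → ℝ) (hf : ∀ i, 0 ≤ f i) :
    1 + ∑ i ∈ s, f i ≤ ∏ i ∈ s, (1 + f i) := by
  classical
  induction s using Finset.induction_on with
  | empty => simp
  | insert a s ha ih =>
    rw [Finset.sum_insert ha, Finset.prod_insert ha]
    have := Finset.sum_nonneg fun i (_ : i ∈ s) => hf i
    nlinarith [hf a, mul_nonneg (hf a) this]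

variable {p : ℕ}

/-- Rotation invariance diagonalizes `D`, the integral factors over the eigenvalues, and `∏ (1 + 4
l_k²) ≥ 1 + 4 ∑ l_k²`. -/
theorem norm_integral_cexp_quadratic {D : Matrix (Fin p) (Fin p) ℝ} (hD : D.IsSymm) :
    ‖∫ β, Complex.exp (Complex.I * (β ⬝ᵥ (D *ᵥ β) : ℝ)) ∂gaussVec p‖ ^ 2 ≤
      (√(1 + 4 * frobeniusNorm D ^ 2))⁻¹ := by
  have hH : D.IsHermitian := by
    rw [Matrix.IsHermitian, Matrix.conjTranspose_eq_transpose_of_trivial]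
    exact hD
  let b := hH.eigenvectorBasis
  let l := hH.eigenvalues
  have hb : ∀ k, toOp D (b k) = l k • b k := fun k => by
    ext i
    have := congrFun (hH.mulVec_eigenvectorBasis k) i
    simpa [toOp] using this
  have hquad : ∀ x : Fin p → ℝ, ⟪∑ k, x k • b k, toOp D (∑ k, x k • b k)⟫ =
      ∑ k, l k * x k ^ 2 := by
    intro x
    simp only [map_sum, map_smul, hb, smul_smul]
    rw [b.orthonormal.inner_sum]
    refine Finset.sum_congr rfl fun k _ => ?_
    simp
    ring
  have hF : frobeniusNorm D ^ 2 = ∑ k, l k ^ 2 := by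
    rw [frobeniusNorm_sq_eq_sum b]
    refine Finset.sum_congr rfl fun k _ => ?_
    rw [hb, norm_smul, b.norm_eq_one]
    simp
  let G : EuclideanSpace ℝ (Fin p) → ℂ := fun y => Complex.exp (Complex.I * (⟪y, toOp D y⟫ : ℝ))
  have hG : Continuous G := by
    simp only [G]
    fun_prop
  have hrot : ∫ β, Complex.exp (Complex.I * (β ⬝ᵥ (D *ᵥ β) : ℝ)) ∂gaussVec p =
      ∫ x, G (∑ k, x k • b k) ∂gaussVec p := by
    have e1 := integral_map (μ := gaussVec p) (φ := fun x => ∑ k, x k • b k) (f := G)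
      (by
        have : Measurable fun x : Fin p → ℝ => ∑ k, x k • b k := by fun_prop
        exact this.aemeasurable) hG.aestronglyMeasurable
    have e2 := integral_map (μ := gaussVec p) (φ := WithLp.toLp 2) (f := G)
      (by fun_prop) hG.aestronglyMeasurable
    rw [← stdGaussian_eq_map_pi_orthonormalBasis b] at e1
    rw [map_pi_eq_stdGaussian] at e2
    rw [← e1, e2]
    refine integral_congr_ae (Filter.Eventually.of_forall fun β => ?_)
    simp only [G, Matrix.inner_toEuclideanCLM]
  have hprod : ∫ x, G (∑ k, x k • b k) ∂gaussVec p =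
      ∏ k, ∫ x : ℝ, Complex.exp (Complex.I * (l k * x ^ 2 : ℝ)) ∂gaussianReal 0 1 := by
    rw [← integral_fintype_prod_eq_prod
      (f := fun k (x : ℝ) => Complex.exp (Complex.I * (l k * x ^ 2 : ℝ)))]
    refine integral_congr_ae (Filter.Eventually.of_forall fun x => ?_)
    simp only [G, hquad]
    rw [← Complex.exp_sum, ← Finset.mul_sum, ← Complex.ofReal_sum]
  rw [hrot, hprod, norm_prod, ← Finset.prod_pow]
  simp only [norm_integral_cexp_mul_sq_gaussianReal]
  rw [Finset.prod_inv_distrib, ← Real.sqrt_prod _ fun _ _ => by positivity]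
  refine inv_anti₀ (Real.sqrt_pos.2 (by positivity)) (Real.sqrt_le_sqrt ?_)
  rw [hF, Finset.mul_sum]
  exact one_add_sum_le_prod_one_add _ _ fun k => by positivity

/-- For a difference of two independent copies the characteristic function is `|φ|²`, here at most
`1/√5 ≤ 1/2`. -/
theorem integral_cos_frobInner_pairMat_le {D : Matrix (Fin p) (Fin p) ℝ} (hD : D.IsSymm)
    (hF : frobeniusNorm D = 1) :
    ∫ b, Real.cos (frobInner D (pairMat b)) ∂gaussPair p ≤ 1 / 2 := by
  have hform : ∀ b : (Fin p → ℝ) × (Fin p → ℝ),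
      frobInner D (pairMat b) = b.1 ⬝ᵥ (D *ᵥ b.1) - b.2 ⬝ᵥ (D *ᵥ b.2) := fun b => by
    rw [pairMat, frobInner_sub_right, frobInner_vecMulVec, frobInner_vecMulVec]
  set φ := ∫ β, Complex.exp (Complex.I * (β ⬝ᵥ (D *ᵥ β) : ℝ)) ∂gaussVec p with hφ
  have hconj : ∫ β, Complex.exp (-(Complex.I * (β ⬝ᵥ (D *ᵥ β) : ℝ))) ∂gaussVec p =
      (starRingEnd ℂ) φ := by
    rw [hφ, ← integral_conj]
    refine integral_congr_ae (Filter.Eventually.of_forall fun β => ?_)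
    simp only [← Complex.exp_conj, map_mul, Complex.conj_I, Complex.conj_ofReal, neg_mul]
  have hre : ∫ b, Real.cos (frobInner D (pairMat b)) ∂gaussPair p = ‖φ‖ ^ 2 := by
    have e1 : ∀ b : (Fin p → ℝ) × (Fin p → ℝ), Real.cos (frobInner D (pairMat b)) =
        (Complex.exp (Complex.I * (b.1 ⬝ᵥ (D *ᵥ b.1) : ℝ)) *
          Complex.exp (-(Complex.I * (b.2 ⬝ᵥ (D *ᵥ b.2) : ℝ)))).re := by
      intro b
      rw [← Complex.exp_add, hform, ← Complex.exp_ofReal_mul_I_re]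
      congr 2
      push_cast
      ring
    simp_rw [e1]
    have hc : Continuous fun b : (Fin p → ℝ) × (Fin p → ℝ) =>
        Complex.exp (Complex.I * (b.1 ⬝ᵥ (D *ᵥ b.1) : ℝ)) *
          Complex.exp (-(Complex.I * (b.2 ⬝ᵥ (D *ᵥ b.2) : ℝ))) := by
      simp only [dotProduct, Matrix.mulVec]
      fun_prop
    have hint : Integrable (fun b : (Fin p → ℝ) × (Fin p → ℝ) =>
        Complex.exp (Complex.I * (b.1 ⬝ᵥ (D *ᵥ b.1) : ℝ)) *
          Complex.exp (-(Complex.I * (b.2 ⬝ᵥ (D *ᵥ b.2) : ℝ)))) (gaussPair p) := by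
      refine Integrable.of_bound hc.aestronglyMeasurable 1 (Filter.Eventually.of_forall fun b => ?_)
      rw [norm_mul, Complex.norm_exp, Complex.norm_exp]
      simp
    have e2 := integral_re hint
    simp only [RCLike.re_to_complex] at e2
    rw [e2, integral_prod_mul (fun β => Complex.exp (Complex.I * (β ⬝ᵥ (D *ᵥ β) : ℝ)))
      (fun β => Complex.exp (-(Complex.I * (β ⬝ᵥ (D *ᵥ β) : ℝ)))), hconj, ← hφ, Complex.mul_conj,
      Complex.ofReal_re, Complex.normSq_eq_norm_sq]
  rw [hre]
  refine (norm_integral_cexp_quadratic hD).trans ?_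
  rw [hF, one_div]
  refine inv_anti₀ (by norm_num) (Real.le_sqrt_of_sq_le (by norm_num))

/-- Because `1 - cos x = 2 sin² (x/2) ≤ 2 |sin (x/2)|`. It gives a bounded minorant of `|x|`, with
no integrability to check. -/
theorem one_sub_cos_le_abs (x : ℝ) : 1 - Real.cos x ≤ |x| := by
  have h1 : Real.cos x = 2 * Real.cos (x / 2) ^ 2 - 1 := by
    rw [← Real.cos_two_mul]
    congr 1
    ring
  have h2 := Real.sin_sq_add_cos_sq (x / 2)
  have h3 := Real.abs_sin_le_abs (x := x / 2)
  have h4 := Real.abs_sin_le_one (x / 2)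
  have h5 : |x / 2| = |x| / 2 := by rw [abs_div, abs_two]
  have h6 := sq_abs (Real.sin (x / 2))
  nlinarith [abs_nonneg (Real.sin (x / 2))]

theorem measurable_frobInner_pairMat (D : Matrix (Fin p) (Fin p) ℝ) :
    Measurable fun b : (Fin p → ℝ) × (Fin p → ℝ) => frobInner D (pairMat b) := by
  unfold frobInner
  have := measurable_pairMat_apply (p := p)
  fun_prop

/-- The exponential moments of `|bᵀ D b - b'ᵀ D b'|` are at least those of the constant `1 / 2`. -/
theorem exp_half_le_lintegral_exp_abs {D : Matrix (Fin p) (Fin p) ℝ} (hD : D.IsSymm)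
    (hF : frobeniusNorm D = 1) {l : ℝ} (hl : 0 ≤ l) :
    ENNReal.ofReal (Real.exp (2 * l * (1 / 2))) ≤
      ∫⁻ b, ENNReal.ofReal (Real.exp (2 * l * |frobInner D (pairMat b)|)) ∂gaussPair p := by
  have hmeas := measurable_frobInner_pairMat D
  have hcos : Integrable (fun b => Real.cos (frobInner D (pairMat b))) (gaussPair p) :=
    Integrable.of_bound (Real.measurable_cos.comp hmeas).aestronglyMeasurable 1
      (Filter.Eventually.of_forall fun b => Real.abs_cos_le_one _)
  have hexp : Integrable (fun b => Real.exp (2 * l * (1 - Real.cos (frobInner D (pairMat b)))))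
      (gaussPair p) := by
    refine Integrable.of_bound (Real.measurable_exp.comp (((measurable_const (a := (1 : ℝ))).sub
      (Real.measurable_cos.comp hmeas)).const_mul _)).aestronglyMeasurable (Real.exp (2 * l * 2))
      (Filter.Eventually.of_forall fun b => ?_)
    rw [Real.norm_eq_abs, Real.abs_exp]
    have := Real.neg_one_le_cos (frobInner D (pairMat b))
    gcongr
    linarith
  -- Jensen's inequality by hand: the tangent to `exp` at `l`, using that `1 - cos Y` has mean at
  -- least `1/2`.
  have hval : Real.exp l ≤
      ∫ b, Real.exp (2 * l * (1 - Real.cos (frobInner D (pairMat b)))) ∂gaussPair p := by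
    calc Real.exp l ≤ Real.exp l *
          ((1 + l) - 2 * l * ∫ b, Real.cos (frobInner D (pairMat b)) ∂gaussPair p) := by
          have h1 := integral_cos_frobInner_pairMat_le hD hF
          have h2 : 1 ≤ (1 + l) - 2 * l * ∫ b, Real.cos (frobInner D (pairMat b)) ∂gaussPair p := by
            nlinarith
          nlinarith [Real.exp_pos l]
      _ = ∫ b, Real.exp l * ((1 + l) - 2 * l * Real.cos (frobInner D (pairMat b)))
            ∂gaussPair p := by
          rw [integral_const_mul, integral_sub (integrable_const _) (hcos.const_mul _),
            integral_const_mul]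
          simp
      _ ≤ _ := by
          refine integral_mono (((integrable_const _).sub (hcos.const_mul _)).const_mul _) hexp
            fun b => ?_
          have h5 := Real.add_one_le_exp (2 * l * (1 - Real.cos (frobInner D (pairMat b))) - l)
          calc _ ≤ Real.exp l *
                Real.exp (2 * l * (1 - Real.cos (frobInner D (pairMat b))) - l) := by
                gcongr
                linarith
            _ = Real.exp (2 * l * (1 - Real.cos (frobInner D (pairMat b)))) := by
                rw [← Real.exp_add]
                congr 1
                ring
  have h3 : (2 * l * (1 / 2) : ℝ) = l := by ring
  rw [h3]
  calc ENNReal.ofReal (Real.exp l) ≤ ENNReal.ofReal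
        (∫ b, Real.exp (2 * l * (1 - Real.cos (frobInner D (pairMat b)))) ∂gaussPair p) :=
        ENNReal.ofReal_le_ofReal hval
    _ = ∫⁻ b, ENNReal.ofReal (Real.exp (2 * l * (1 - Real.cos (frobInner D (pairMat b)))))
          ∂gaussPair p :=
        ofReal_integral_eq_lintegral_ofReal hexp (Filter.Eventually.of_forall fun _ => by positivity)
    _ ≤ _ := lintegral_mono fun b => by
        have h4 := one_sub_cos_le_abs (frobInner D (pairMat b))
        gcongr

end SmallBall

/-! ### The uniform lower bound over the cone -/

section LowerBound

variable {m p : ℕ}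

/-- The restricted lower bound in terms of pairs of vectors. -/
def PairLowerBound (r : ℕ) (b : Fin m → (Fin p → ℝ) × (Fin p → ℝ)) : Prop :=
  ∀ D : Matrix (Fin p) (Fin p) ℝ, D.IsSymm → nuclearNorm D ≤ 5 * √r * frobeniusNorm D →
    (m : ℝ) / 4 * frobeniusNorm D ≤ ∑ i, |frobInner D (pairMat (b i))|

theorem continuous_frobInner_left (B : Matrix (Fin p) (Fin p) ℝ) :
    Continuous fun D : Matrix (Fin p) (Fin p) ℝ => frobInner D B := by
  unfold frobInner
  fun_prop

theorem measurePreserving_swap_gaussPair :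
    MeasurePreserving Prod.swap (gaussPair p) (gaussPair p) :=
  Measure.measurePreserving_swap

/-- By homogeneity and continuity it suffices to check the lower bound on a dense set of
normalized matrices. -/
theorem pairLowerBound_of_dense {r : ℕ} {b : Fin m → (Fin p → ℝ) × (Fin p → ℝ)}
    {s : Set {D : Matrix (Fin p) (Fin p) ℝ //
      D.IsSymm ∧ frobeniusNorm D = 1 ∧ nuclearNorm D ≤ 5 * √r}} (hs : Dense s)
    (h : ∀ D ∈ s, (m : ℝ) / 4 ≤ ∑ i, |frobInner D.1 (pairMat (b i))|) : PairLowerBound r b := by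
  have hall : ∀ D : {D : Matrix (Fin p) (Fin p) ℝ //
      D.IsSymm ∧ frobeniusNorm D = 1 ∧ nuclearNorm D ≤ 5 * √r},
      (m : ℝ) / 4 ≤ ∑ i, |frobInner D.1 (pairMat (b i))| := by
    have hc : IsClosed {D : {D : Matrix (Fin p) (Fin p) ℝ //
        D.IsSymm ∧ frobeniusNorm D = 1 ∧ nuclearNorm D ≤ 5 * √r} |
        (m : ℝ) / 4 ≤ ∑ i, |frobInner D.1 (pairMat (b i))|} := by
      refine isClosed_le continuous_const (continuous_finsetSum _ fun i _ => ?_)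
      exact ((continuous_frobInner_left _).comp continuous_subtype_val).abs
    intro D
    have := hc.closure_subset_iff.2 (fun D hD => h D hD) (hs D)
    exact this
  intro D hD hnuc
  rcases (frobeniusNorm_nonneg D).eq_or_lt with hF | hF
  · rw [← hF, mul_zero]
    positivity
  · set F := frobeniusNorm D with hFdef
    have h1 := hall ⟨F⁻¹ • D, by rw [Matrix.IsSymm, Matrix.transpose_smul, hD.eq],
      by rw [frobeniusNorm_smul, abs_of_pos (inv_pos.2 hF), inv_mul_cancel₀ hF.ne'],
      by
        refine (nuclearNorm_smul_le (inv_nonneg.2 hF.le) D).trans ?_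
        rw [inv_mul_le_iff₀ hF]
        linarith⟩
    simp only [frobInner_smul_left, abs_mul, abs_of_pos (inv_pos.2 hF)] at h1
    rw [← Finset.mul_sum, ← div_eq_inv_mul, le_div_iff₀ hF] at h1
    exact h1

/-- The restricted lower bound fails with exponentially small probability. -/
theorem measure_not_pairLowerBound_le (hp : 1 ≤ p) {r : ℕ} (hr : 1 ≤ r) :
    gaussPairs m p {b | ¬PairLowerBound r b} ≤
      ENNReal.ofReal (2 * 9 ^ p * Real.exp (-(m / (102400 * r)))) := by
  have hr0 : (1 : ℝ) ≤ r := by exact_mod_cast hr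
  have hsep : SecondCountableTopology (Matrix (Fin p) (Fin p) ℝ) :=
    inferInstanceAs (SecondCountableTopology (Fin p → Fin p → ℝ))
  have hsep' : SecondCountableTopology {D : Matrix (Fin p) (Fin p) ℝ //
      D.IsSymm ∧ frobeniusNorm D = 1 ∧ nuclearNorm D ≤ 5 * √r} :=
    TopologicalSpace.Subtype.secondCountableTopology _
  -- A countable index set keeps the suprema measurable.
  obtain ⟨s, hsc, hsd⟩ := TopologicalSpace.exists_countable_dense
    {D : Matrix (Fin p) (Fin p) ℝ // D.IsSymm ∧ frobeniusNorm D = 1 ∧ nuclearNorm D ≤ 5 * √r}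
  have : Countable s := hsc.to_subtype
  -- The minimizer of `-l/4 + 1600 r l²`, the exponent per pair; the minimum is `-1/(102400 r)`.
  set l : ℝ := 1 / (12800 * r) with hl
  have hl0 : 0 ≤ l := by positivity
  let Y : s → (Fin p → ℝ) × (Fin p → ℝ) → ℝ := fun t b => frobInner t.1.1 (pairMat b)
  have hY : ∀ t, Measurable (Y t) := fun t => measurable_frobInner_pairMat _
  have hodd : ∀ t b, Y t b.swap = -Y t b := fun t b => by
    simp only [Y, pairMat, Prod.fst_swap, Prod.snd_swap, frobInner_sub_right]
    ring
  let f : s → (Fin p → ℝ) × (Fin p → ℝ) → ℝ≥0∞ := fun t b =>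
    ENNReal.ofReal (Real.exp (l * (1 / 2 - |Y t b|)))
  let g : s → (Fin p → ℝ) × (Fin p → ℝ) → ℝ≥0∞ := fun t b =>
    ENNReal.ofReal (Real.exp (2 * l * Y t b))
  have hf : ∀ t, Measurable (f t) := fun t => by
    have := hY t
    fun_prop
  have hg : ∀ t, Measurable (g t) := fun t => by
    have := hY t
    fun_prop
  have hstep : ∀ a : s → ℝ≥0∞, ∫⁻ x, ⨆ t, a t * f t x ∂gaussPair p ≤
      ∫⁻ x, ⨆ t, a t * g t x ∂gaussPair p := fun a =>
    lintegral_iSup_exp_le hY measurePreserving_swap_gaussPair hodd hl0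
      (fun t => exp_half_le_lintegral_exp_abs t.1.2.1 t.1.2.2.1 hl0) a
  have hiter := lintegral_iSup_prod_le hf hg hstep m (fun _ => 1)
  simp only [one_mul] at hiter
  have hprodf : ∀ (t : s) (b : Fin m → (Fin p → ℝ) × (Fin p → ℝ)), ∏ i : Fin m, f t (b i) =
      ENNReal.ofReal (Real.exp (l * (m / 2 - ∑ i, |Y t (b i)|))) := by
    intro t b
    rw [← ENNReal.ofReal_prod_of_nonneg fun _ _ => Real.exp_nonneg _, ← Real.exp_sum,
      ← Finset.mul_sum, Finset.sum_sub_distrib]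
    simp [div_eq_mul_inv]
  have hprodg : ∀ (t : s) (b : Fin m → (Fin p → ℝ) × (Fin p → ℝ)), ∏ i : Fin m, g t (b i) =
      ENNReal.ofReal (Real.exp (2 * l * ∑ i, Y t (b i))) := by
    intro t b
    rw [← ENNReal.ofReal_prod_of_nonneg fun _ _ => Real.exp_nonneg _, ← Real.exp_sum,
      ← Finset.mul_sum]
  -- Failure means `∑ |Y_D| < m/4` for some `D`, a deficit of `m/4` below the centring `m/2`.
  have hsub : {b | ¬PairLowerBound r b} ⊆
      {b : Fin m → (Fin p → ℝ) × (Fin p → ℝ) |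
        ENNReal.ofReal (Real.exp (l * (m / 4))) ≤ ⨆ t, ∏ i, f t (b i)} := by
    intro b hb
    have : ∃ D ∈ s, ∑ i, |frobInner D.1 (pairMat (b i))| < (m : ℝ) / 4 := by
      by_contra! hcon
      exact hb (pairLowerBound_of_dense hsd hcon)
    obtain ⟨D, hD, hlt⟩ := this
    refine le_trans ?_ (le_iSup (fun t => ∏ i, f t (b i)) ⟨D, hD⟩)
    rw [hprodf]
    refine ENNReal.ofReal_le_ofReal (Real.exp_le_exp.2 (mul_le_mul_of_nonneg_left ?_ hl0))
    simp only [Y]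
    linarith
  -- Equal to `20 l √r`: the factor `2l` times the cone constant `5√r`, doubled to match the halved
  -- spectral norm in the moment bound.
  set S : ℝ := √r / (640 * r) with hS
  have hS0 : 0 ≤ S := by positivity
  have hS2 : S ^ 2 = 1 / (409600 * r) := by
    rw [hS, div_pow, Real.sq_sqrt (by positivity)]
    field_simp
    norm_num
  have hS3 : 2 * l * (5 * √r) = S / 2 := by
    rw [hl, hS]
    field_simp
    norm_num
  have hg_le : ∀ b : Fin m → (Fin p → ℝ) × (Fin p → ℝ), ⨆ t, ∏ i, g t (b i) ≤
      ENNReal.ofReal (Real.exp (S * (specNorm (∑ i, (1 : ℝ) • pairMat (b i)) / 2))) := by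
    intro b
    refine iSup_le fun t => ?_
    rw [hprodg]
    refine ENNReal.ofReal_le_ofReal (Real.exp_le_exp.2 ?_)
    simp only [one_smul]
    have h1 : ∑ i, Y t (b i) ≤ 5 * √r * specNorm (∑ i, pairMat (b i)) := by
      simp only [Y]
      rw [← frobInner_sum_right]
      exact (frobInner_le_nuclearNorm _ _).trans
        (mul_le_mul_of_nonneg_right t.1.2.2.2 (norm_nonneg _))
    calc 2 * l * ∑ i, Y t (b i) ≤ 2 * l * (5 * √r * specNorm (∑ i, pairMat (b i))) := by gcongr
      _ = S * (specNorm (∑ i, pairMat (b i)) / 2) := by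
          rw [← mul_assoc, hS3]
          ring
  have hspec := lintegral_exp_specNorm_le (m := m) hp (fun _ => (1 : ℝ)) hS0 (fun _ => by
    rw [mul_one, hS2]
    have : 1 / (409600 * (r : ℝ)) ≤ 1 / 409600 := by
      gcongr
      linarith
    linarith)
  have hmark := mul_meas_ge_le_lintegral₀ (μ := gaussPairs m p)
    (f := fun b => ⨆ t, ∏ i, f t (b i))
    (Measurable.iSup fun t => Finset.measurable_prod _ fun i _ =>
      (hf t).comp (measurable_pi_apply i)).aemeasurable
    (ENNReal.ofReal (Real.exp (l * (m / 4))))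
  have hfinal : ENNReal.ofReal (Real.exp (l * (m / 4))) *
      gaussPairs m p {b | ¬PairLowerBound r b} ≤
      ENNReal.ofReal (2 * 9 ^ p * Real.exp (4 * S ^ 2 * ∑ _i : Fin m, (1 : ℝ) ^ 2)) :=
    calc _ ≤ _ := mul_le_mul_right (measure_mono hsub) _
      _ ≤ _ := hmark
      _ ≤ _ := hiter
      _ ≤ _ := lintegral_mono hg_le
      _ ≤ _ := hspec
  have hpos : ENNReal.ofReal (Real.exp (l * (m / 4))) ≠ 0 := by
    simp [Real.exp_pos]
  rw [mul_comm, ← ENNReal.le_div_iff_mul_le (Or.inl hpos) (Or.inl ENNReal.ofReal_ne_top),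
    ← ENNReal.ofReal_div_of_pos (Real.exp_pos _)] at hfinal
  refine hfinal.trans (le_of_eq ?_)
  congr 1
  rw [mul_div_assoc, ← Real.exp_sub, hS2, hl]
  congr 2
  simp
  field_simp
  ring

end LowerBound

/-! ### Size of the Gaussian noise -/

section Noise

theorem integral_abs_gaussianReal : ∫ x, |x| ∂gaussianReal 0 1 = 2 / √(2 * Real.pi) := by
  rw [integral_gaussianReal_eq_integral_smul one_ne_zero]
  have h1 : ∀ x : ℝ, gaussianPDFReal 0 1 x • |x| =
      (√(2 * Real.pi))⁻¹ * (|x| ^ (1 : ℝ) * Real.exp (-(1 / 2) * |x| ^ (2 : ℝ))) := by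
    intro x
    rw [gaussianPDFReal, smul_eq_mul, Real.rpow_one, Real.rpow_two, sq_abs]
    simp only [NNReal.coe_one, sub_zero, mul_one]
    rw [mul_assoc, mul_comm |x|]
    congr 3
    ring
  simp_rw [h1]
  rw [integral_const_mul,
    integral_comp_abs (f := fun x => x ^ (1 : ℝ) * Real.exp (-(1 / 2) * x ^ (2 : ℝ))),
    integral_rpow_mul_exp_neg_mul_rpow (by norm_num) (by norm_num) (by norm_num)]
  norm_num
  field_simp

theorem integral_abs_gaussianReal_le : ∫ x, |x| ∂gaussianReal 0 1 ≤ 4 / 5 := by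
  rw [integral_abs_gaussianReal, div_le_iff₀ (by positivity)]
  have h : 5 / 2 ≤ √(2 * Real.pi) := by
    refine Real.le_sqrt_of_sq_le ?_
    have := Real.pi_gt_d2
    norm_num at this ⊢
    linarith
  linarith

variable {n : ℕ}

/-- The mean absolute value of standard Gaussian noise exceeds one with small probability. -/
theorem measure_sum_abs_gt_le (hn : 1 ≤ n) :
    gaussVec n {ζ | (n : ℝ) < ∑ i, |ζ i|} ≤ ENNReal.ofReal (9 / n) := by
  have hn0 : (1 : ℝ) ≤ n := by exact_mod_cast hn
  have hLp : MemLp (fun x : ℝ => |x|) 2 (gaussianReal 0 1) := (memLp_id_gaussianReal' 2 (by simp)).abs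
  set κ := ∫ x, |x| ∂gaussianReal 0 1 with hκ
  have hκ1 : κ ≤ 4 / 5 := integral_abs_gaussianReal_le
  have hκ0 : 0 ≤ κ := integral_nonneg fun _ => abs_nonneg _
  have hvar1 : Var[fun x : ℝ => |x|; gaussianReal 0 1] = 1 - κ ^ 2 := by
    rw [variance_eq_sub hLp]
    have h2 := variance_eq_sub (memLp_id_gaussianReal' (μ := 0) (v := 1) 2 (by simp))
    rw [variance_id_gaussianReal] at h2
    have e1 : ∫ x, ((fun x : ℝ => |x|) ^ 2) x ∂gaussianReal 0 1 =
        ∫ x, (id ^ 2 : ℝ → ℝ) x ∂gaussianReal 0 1 :=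
      integral_congr_ae (Filter.Eventually.of_forall fun x => by simp)
    rw [e1]
    simp only [id_eq, integral_id_gaussianReal, NNReal.coe_one] at h2
    linarith
  have hvar : Var[∑ i : Fin n, fun ζ : Fin n → ℝ => |ζ i|; gaussVec n] = n * (1 - κ ^ 2) := by
    have := variance_sum_pi (μ := fun _ : Fin n => gaussianReal 0 1) (X := fun _ x => |x|)
      fun _ => hLp
    rw [this]
    simp only [hvar1, Finset.sum_const, Finset.card_univ, Fintype.card_fin, nsmul_eq_mul]
  have hint : Integrable (fun x : ℝ => |x|) (gaussianReal 0 1) := hLp.integrable (by norm_num)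
  have hmean : ∫ ζ, (∑ i : Fin n, fun ζ : Fin n → ℝ => |ζ i|) ζ ∂gaussVec n = n * κ := by
    simp only [Finset.sum_apply]
    rw [integral_finsetSum _ fun i _ => integrable_comp_eval
      (μ := fun _ : Fin n => gaussianReal 0 1) (i := i) (f := fun x : ℝ => |x|) hint]
    have e1 : ∀ i : Fin n, ∫ ζ, |ζ i| ∂gaussVec n = κ := fun i =>
      integral_comp_eval (μ := fun _ : Fin n => gaussianReal 0 1) (i := i) (f := fun x : ℝ => |x|) hint.aestronglyMeasurable
    simp [e1]
  have hmem : MemLp (∑ i : Fin n, fun ζ : Fin n → ℝ => |ζ i|) 2 (gaussVec n) := by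
    refine memLp_finsetSum' _ fun i _ => ?_
    exact hLp.comp_measurePreserving (measurePreserving_eval (fun _ : Fin n => gaussianReal 0 1) i)
  -- Chebyshev gives `(1 + κ) / (n (1 - κ))`, which is at most `9/n` when `κ ≤ 4/5`.
  have hcheb := meas_ge_le_variance_div_sq hmem (c := n * (1 - κ)) (by nlinarith)
  rw [hvar, hmean] at hcheb
  refine (measure_mono fun ζ hζ => ?_).trans (hcheb.trans (ENNReal.ofReal_le_ofReal ?_))
  · simp only [Set.mem_ofPred_eq, Finset.sum_apply] at hζ ⊢
    refine le_trans ?_ (le_abs_self _)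
    linarith
  · have hpos : 0 < (n : ℝ) * (1 - κ) := mul_pos (by linarith) (by linarith)
    rw [div_le_div_iff₀ (pow_pos hpos 2) (by linarith)]
    have : (1 + κ) * 1 ≤ 9 * (1 - κ) := by linarith
    have h2 : (n : ℝ) * (1 - κ ^ 2) * n = n ^ 2 * (1 - κ) * ((1 + κ) * 1) := by ring
    rw [h2]
    have h3 : 9 * ((n : ℝ) * (1 - κ)) ^ 2 = n ^ 2 * (1 - κ) * (9 * (1 - κ)) := by ring
    rw [h3]
    refine mul_le_mul_of_nonneg_left this (mul_nonneg (by positivity) (by linarith))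

theorem gaussianReal_abs_gt_le {t : ℝ} (ht : 0 ≤ t) :
    gaussianReal 0 1 {x | t < |x|} ≤ ENNReal.ofReal (2 * Real.exp (-(t ^ 2 / 2))) := by
  have h1 : gaussianReal 0 1 {x : ℝ | t ≤ x} ≤ ENNReal.ofReal (Real.exp (-(t ^ 2 / 2))) := by
    have h := measure_ge_le_exp_mul_mgf (μ := gaussianReal 0 1) (X := id) t ht
      (integrable_exp_mul_gaussianReal t)
    rw [mgf_id_gaussianReal, ← Real.exp_add] at h
    rw [← ofReal_measureReal (s := {x : ℝ | t ≤ x})]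
    refine ENNReal.ofReal_le_ofReal (h.trans (le_of_eq ?_))
    congr 1
    simp only [NNReal.coe_one]
    ring
  have h2 : gaussianReal 0 1 {x : ℝ | t ≤ -x} ≤ ENNReal.ofReal (Real.exp (-(t ^ 2 / 2))) := by
    have e : gaussianReal 0 1 = (gaussianReal 0 1).map fun x : ℝ => -x := by
      rw [gaussianReal_map_neg, neg_zero]
    rw [e, Measure.map_apply measurable_neg (measurableSet_le measurable_const measurable_neg)]
    simpa using h1
  calc gaussianReal 0 1 {x | t < |x|}
      ≤ gaussianReal 0 1 ({x : ℝ | t ≤ x} ∪ {x : ℝ | t ≤ -x}) := measure_mono fun x hx => by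
        rw [Set.mem_ofPred_eq] at hx
        rcases lt_abs.1 hx with h | h
        · exact Or.inl h.le
        · exact Or.inr h.le
    _ ≤ _ := measure_union_le _ _
    _ ≤ _ := add_le_add h1 h2
    _ = _ := by
        rw [← ENNReal.ofReal_add (by positivity) (by positivity), two_mul]

/-- The largest of `n` standard Gaussian variables. -/
theorem measure_exists_abs_gt_le (hn : 1 ≤ n) :
    gaussVec n {ζ | ∃ i, 2 * √(Real.log n) < |ζ i|} ≤ ENNReal.ofReal (2 / n) := by
  have hn0 : (1 : ℝ) ≤ n := by exact_mod_cast hn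
  have hone : ∀ i : Fin n, gaussVec n {ζ | 2 * √(Real.log n) < |ζ i|} ≤
      ENNReal.ofReal (2 / n ^ 2) := by
    intro i
    have h1 := gaussianReal_abs_gt_le (t := 2 * √(Real.log n)) (by positivity)
    have h2 := (measurePreserving_eval (fun _ : Fin n => gaussianReal 0 1) i).measure_preimage
      (s := {x : ℝ | 2 * √(Real.log n) < |x|})
      (measurableSet_lt measurable_const measurable_abs).nullMeasurableSet
    refine (le_of_eq h2).trans (h1.trans (le_of_eq ?_))
    rw [mul_pow, Real.sq_sqrt (Real.log_natCast_nonneg n)]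
    have e : -(2 ^ 2 * Real.log n / 2) = -Real.log ((n : ℝ) ^ 2) := by
      rw [Real.log_pow]
      push_cast
      ring
    rw [e, Real.exp_neg, Real.exp_log (by positivity), div_eq_mul_inv]
  rw [Set.ofPred_exists]
  refine (measure_iUnion_fintype_le _ _).trans ((Finset.sum_le_sum fun i _ => hone i).trans
    (le_of_eq ?_))
  rw [Finset.sum_const, Finset.card_univ, Fintype.card_fin, nsmul_eq_mul,
    ← ENNReal.ofReal_natCast n, ← ENNReal.ofReal_mul (by positivity)]
  congr 1
  field_simp

/-- The sum of squares of standard Gaussian variables. -/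
theorem measure_sum_sq_gt_le :
    gaussVec n {ζ | 3 / 2 * (n : ℝ) < ∑ i, ζ i ^ 2} ≤ ENNReal.ofReal (Real.exp (-(n / 40))) := by
  have hprod : ∀ ζ : Fin n → ℝ, ENNReal.ofReal (Real.exp (1 / 4 * ∑ i, ζ i ^ 2)) =
      ∏ i, ENNReal.ofReal (Real.exp (1 / 4 * ζ i ^ 2)) := fun ζ => by
    rw [← ENNReal.ofReal_prod_of_nonneg fun _ _ => Real.exp_nonneg _, ← Real.exp_sum,
      Finset.mul_sum]
  have hint : ∫⁻ ζ, ENNReal.ofReal (Real.exp (1 / 4 * ∑ i, ζ i ^ 2)) ∂gaussVec n ≤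
      ENNReal.ofReal (Real.exp (7 / 20 * n)) := by
    simp_rw [hprod]
    rw [lintegral_pi_prod (fun _ : Fin n => gaussianReal 0 1)
      (fun _ x => ENNReal.ofReal (Real.exp (1 / 4 * x ^ 2))) fun _ => by fun_prop]
    rw [Finset.prod_const, lintegral_exp_mul_sq_gaussianReal (by norm_num), Finset.card_univ,
      Fintype.card_fin, ← ENNReal.ofReal_pow (by positivity)]
    refine ENNReal.ofReal_le_ofReal ?_
    have h1 : (√(1 - 2 * (1 / 4 : ℝ)))⁻¹ ≤ Real.exp (7 / 20) := by
      rw [inv_le_comm₀ (Real.sqrt_pos.2 (by norm_num)) (Real.exp_pos _), ← Real.exp_neg]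
      refine Real.le_sqrt_of_sq_le ?_
      rw [← Real.exp_nat_mul, ← Real.le_log_iff_exp_le (by norm_num)]
      have e : (1 - 2 * (1 / 4) : ℝ) = 2⁻¹ := by norm_num
      rw [e, Real.log_inv]
      have := Real.log_two_lt_d9
      push_cast
      linarith
    refine (pow_le_pow_left₀ (by positivity) h1 n).trans (le_of_eq ?_)
    rw [← Real.exp_nat_mul, mul_comm]
  have hmark := mul_meas_ge_le_lintegral₀ (μ := gaussVec n)
    (f := fun ζ => ENNReal.ofReal (Real.exp (1 / 4 * ∑ i, ζ i ^ 2)))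
    (by
      have : Measurable fun ζ : Fin n → ℝ => ENNReal.ofReal (Real.exp (1 / 4 * ∑ i, ζ i ^ 2)) := by
        fun_prop
      exact this.aemeasurable)
    -- Chernoff at parameter `1/4`: the threshold contributes `3/8`, the moment `√2 ≤ exp (7/20)`,
    -- and the difference is `1/40`.
    (ENNReal.ofReal (Real.exp (3 / 8 * n)))
  have hsub : {ζ : Fin n → ℝ | 3 / 2 * (n : ℝ) < ∑ i, ζ i ^ 2} ⊆
      {ζ | ENNReal.ofReal (Real.exp (3 / 8 * n)) ≤
        ENNReal.ofReal (Real.exp (1 / 4 * ∑ i, ζ i ^ 2))} := fun ζ hζ => by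
    simp only [Set.mem_ofPred_eq] at hζ ⊢
    refine ENNReal.ofReal_le_ofReal (Real.exp_le_exp.2 ?_)
    linarith
  have hfinal := (mul_le_mul_right (measure_mono (μ := gaussVec n) hsub)
    (ENNReal.ofReal (Real.exp (3 / 8 * n)))).trans (hmark.trans hint)
  have hpos : ENNReal.ofReal (Real.exp (3 / 8 * n)) ≠ 0 := by simp [Real.exp_pos]
  rw [mul_comm, ← ENNReal.le_div_iff_mul_le (Or.inl hpos) (Or.inl ENNReal.ofReal_ne_top),
    ← ENNReal.ofReal_div_of_pos (Real.exp_pos _), ← Real.exp_sub] at hfinal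
  refine hfinal.trans (le_of_eq ?_)
  congr 2
  ring

end Noise

/-! ### The dual noise for fixed noise -/

section DualNoise

variable {n p : ℕ}

/-- Turns the size of the net into an exponent that can be added to the others; numerically, `9⁵ ≤
2.7¹²`. -/
theorem nine_pow_le (p : ℕ) : (9 : ℝ) ^ p ≤ Real.exp (12 / 5 * p) := by
  have h : (9 : ℝ) ≤ Real.exp (12 / 5) := by
    refine le_of_pow_le_pow_left₀ (n := 5) (by norm_num) (Real.exp_nonneg _) ?_
    rw [← Real.exp_nat_mul]
    have h1 := Real.exp_one_gt_d9
    have e : Real.exp ((5 : ℕ) * (12 / 5 : ℝ)) = Real.exp 1 ^ 12 := by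
      rw [← Real.exp_nat_mul]
      congr 1
      norm_num
    rw [e]
    calc (9 : ℝ) ^ 5 ≤ 2.7 ^ 12 := by norm_num
      _ ≤ _ := pow_le_pow_left₀ (by norm_num) (by linarith) 12
  calc (9 : ℝ) ^ p ≤ Real.exp (12 / 5) ^ p := pow_le_pow_left₀ (by norm_num) h p
    _ = _ := by rw [← Real.exp_nat_mul, mul_comm]

/-- The tuning parameter at noise level one dominates the dual noise, for fixed noise with
controlled size. -/
theorem measure_specNorm_gt_le (hp : 1 ≤ p) (hn : 2 ≤ n) {ζ : Fin n → ℝ}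
    (hmax : ∀ i, |ζ i| ≤ 2 * √(Real.log n)) (hsq : ∑ i, ζ i ^ 2 ≤ 3 / 2 * (n : ℝ)) :
    gaussPairs (n / 2) p {b | tuning n p 1 < specNorm (∑ i, pairDiff ζ i • pairMat (b i))} ≤
      ENNReal.ofReal (2 * Real.exp (-(p / 10))) := by
  have hn0 : (2 : ℝ) ≤ n := by exact_mod_cast hn
  have hp0 : (1 : ℝ) ≤ p := by exact_mod_cast hp
  have hlog : 0 < Real.log n := Real.log_pos (by linarith)
  set L := √(2 * Real.log n) with hL
  have hL2 : L ^ 2 = 2 * Real.log n := Real.sq_sqrt (by positivity)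
  have hL0 : 0 < L := Real.sqrt_pos.2 (by positivity)
  set x := √((n : ℝ) / p) with hx
  have hx0 : 0 < x := Real.sqrt_pos.2 (by positivity)
  have hx2 : x ^ 2 = n / p := Real.sq_sqrt (by positivity)
  have hpx : √((p : ℝ) * n) = p * x := by
    rw [Real.sqrt_eq_iff_mul_self_eq (by positivity) (by positivity)]
    have : (p : ℝ) * x * (p * x) = p ^ 2 * x ^ 2 := by ring
    rw [this, hx2]
    field_simp
  set M := max x (2 * L) with hM
  have hM0 : 0 < M := lt_max_of_lt_left hx0
  -- The two entries of `M` reflect the two terms of `η`: `x` bounds the variance, `2L` keeps `s`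
  -- within the range of the chi-square moment bound. The exponent per dimension is `12/5 + 27/25 -
  -- 18/5 = -3/25`.
  set s := 3 / 10 / M with hs
  have hs0 : 0 ≤ s := by positivity
  have hsx : s ^ 2 * x ^ 2 ≤ 9 / 100 := by
    rw [hs, div_pow, div_mul_eq_mul_div, div_le_iff₀ (by positivity)]
    have := pow_le_pow_left₀ hx0.le (le_max_left x (2 * L)) 2
    linarith
  have hsL : s ^ 2 * (4 * L ^ 2) ≤ 9 / 100 := by
    rw [hs, div_pow, div_mul_eq_mul_div, div_le_iff₀ (by positivity)]
    have := pow_le_pow_left₀ (by positivity) (le_max_right x (2 * L)) 2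
    rw [mul_pow] at this
    linarith
  have hw2 : ∀ i, pairDiff ζ i ^ 2 ≤ 2 * (ζ (fstIdx i) ^ 2 + ζ (sndIdx i) ^ 2) := fun i => by
    rw [pairDiff]
    nlinarith [sq_nonneg (ζ (fstIdx i) + ζ (sndIdx i))]
  have hsqmax : ∀ i, ζ i ^ 2 ≤ 2 * L ^ 2 := fun i => by
    have h1 := pow_le_pow_left₀ (abs_nonneg _) (hmax i) 2
    rw [sq_abs, mul_pow, Real.sq_sqrt hlog.le] at h1
    linarith
  have hwmax : ∀ i, 4 * (s * pairDiff ζ i) ^ 2 ≤ 3 / 4 := fun i => by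
    have h1 : pairDiff ζ i ^ 2 ≤ 8 * L ^ 2 := by
      have h2 := hw2 i
      have h3 := hsqmax (fstIdx i)
      have h4 := hsqmax (sndIdx i)
      linarith
    rw [mul_pow]
    have h5 := mul_le_mul_of_nonneg_left h1 (sq_nonneg s)
    linarith
  have hwsum : ∑ i, pairDiff ζ i ^ 2 ≤ 3 * n := by
    refine (Finset.sum_le_sum fun i _ => hw2 i).trans ?_
    rw [← Finset.mul_sum]
    have := sum_pairs_le (w := fun i => ζ i ^ 2) fun i => sq_nonneg _
    linarith
  have hspec := lintegral_exp_specNorm_le hp (pairDiff ζ) hs0 hwmax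
  have hmark := mul_meas_ge_le_lintegral₀ (μ := gaussPairs (n / 2) p)
    (f := fun b => ENNReal.ofReal
      (Real.exp (s * (specNorm (∑ i, pairDiff ζ i • pairMat (b i)) / 2))))
    (by
      have h1 : Measurable fun b : Fin (n / 2) → (Fin p → ℝ) × (Fin p → ℝ) =>
          specNorm (∑ i, pairDiff ζ i • pairMat (b i)) := by
        refine Continuous.measurable (continuous_specNorm.comp ?_)
        unfold pairMat
        fun_prop
      exact (ENNReal.measurable_ofReal.comp (Real.measurable_exp.comp
        ((h1.div_const 2).const_mul s))).aemeasurable)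
    (ENNReal.ofReal (Real.exp (18 / 5 * p)))
  have hsub : {b : Fin (n / 2) → (Fin p → ℝ) × (Fin p → ℝ) |
        tuning n p 1 < specNorm (∑ i, pairDiff ζ i • pairMat (b i))} ⊆
      {b | ENNReal.ofReal (Real.exp (18 / 5 * p)) ≤ ENNReal.ofReal
        (Real.exp (s * (specNorm (∑ i, pairDiff ζ i • pairMat (b i)) / 2)))} := fun b hb => by
    simp only [Set.mem_ofPred_eq] at hb ⊢
    refine ENNReal.ofReal_le_ofReal (Real.exp_le_exp.2 ?_)
    rw [tuning, hpx] at hb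
    have h1 : 24 * 1 * (p * x + 2 * p * L) = 24 * p * (x + 2 * L) := by ring
    rw [h1] at hb
    have h2 : M ≤ x + 2 * L := max_le (by linarith) (by linarith)
    have h3 : 12 * p * M ≤ specNorm (∑ i, pairDiff ζ i • pairMat (b i)) / 2 := by
      have := mul_le_mul_of_nonneg_left h2 (by positivity : (0 : ℝ) ≤ 24 * p)
      linarith
    calc (18 / 5 * p : ℝ) = s * (12 * p * M) := by
          rw [hs]
          field_simp
          norm_num
      _ ≤ _ := mul_le_mul_of_nonneg_left h3 hs0
  have hfinal := (mul_le_mul_right (measure_mono (μ := gaussPairs (n / 2) p) hsub)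
    (ENNReal.ofReal (Real.exp (18 / 5 * p)))).trans (hmark.trans hspec)
  have hpos : ENNReal.ofReal (Real.exp (18 / 5 * p)) ≠ 0 := by simp [Real.exp_pos]
  rw [mul_comm, ← ENNReal.le_div_iff_mul_le (Or.inl hpos) (Or.inl ENNReal.ofReal_ne_top),
    ← ENNReal.ofReal_div_of_pos (Real.exp_pos _)] at hfinal
  refine hfinal.trans (ENNReal.ofReal_le_ofReal ?_)
  have hexp : 4 * s ^ 2 * ∑ i, pairDiff ζ i ^ 2 ≤ 27 / 25 * p := by
    have h1 : (n : ℝ) = p * x ^ 2 := by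
      rw [hx2]
      field_simp
    rw [h1] at hwsum
    have h2 := mul_le_mul_of_nonneg_left hwsum (by positivity : 0 ≤ 4 * s ^ 2)
    have h3 := mul_le_mul_of_nonneg_left hsx (by positivity : (0 : ℝ) ≤ 12 * p)
    linarith
  rw [div_le_iff₀ (Real.exp_pos _)]
  calc 2 * 9 ^ p * Real.exp (4 * s ^ 2 * ∑ i, pairDiff ζ i ^ 2)
      ≤ 2 * Real.exp (12 / 5 * p) * Real.exp (27 / 25 * p) := by
        gcongr
        exact nine_pow_le p
    _ ≤ 2 * Real.exp (-(p / 10)) * Real.exp (18 / 5 * p) := by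
        rw [mul_assoc, mul_assoc, ← Real.exp_add, ← Real.exp_add]
        exact mul_le_mul_of_nonneg_left (Real.exp_le_exp.2 (by linarith)) (by norm_num)

end DualNoise

/-! ### The exceptional set on the canonical space -/

section Canonical

variable {n p : ℕ}

theorem continuous_specNorm_sum_pairMat : Continuous
    fun x : (Fin (n / 2) → (Fin p → ℝ) × (Fin p → ℝ)) × (Fin n → ℝ) =>
      specNorm (∑ i, pairDiff x.2 i • pairMat (x.1 i)) := by
  refine continuous_specNorm.comp ?_
  unfold pairMat pairDiff
  fun_prop

/-- The exceptional set, in terms of pairs of design vectors and noise of level `σ`. -/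
def exceptionalSet (n p r : ℕ) (σ : ℝ) :
    Set ((Fin (n / 2) → (Fin p → ℝ) × (Fin p → ℝ)) × (Fin n → ℝ)) :=
  {x | σ * n < ∑ i, |x.2 i|} ∪
    {x | tuning n p σ < specNorm (∑ i, pairDiff x.2 i • pairMat (x.1 i))} ∪
    {x | ¬PairLowerBound r x.1}

/-- Gives measurability. Failure of the lower bound is an uncountable union over `D`, but of open
sets. -/
theorem isOpen_exceptionalSet (n p r : ℕ) (σ : ℝ) : IsOpen (exceptionalSet n p r σ) := by
  refine ((isOpen_lt continuous_const (by fun_prop)).union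
    (isOpen_lt continuous_const continuous_specNorm_sum_pairMat)).union ?_
  have h : {x : (Fin (n / 2) → (Fin p → ℝ) × (Fin p → ℝ)) × (Fin n → ℝ) |
      ¬PairLowerBound r x.1} =
      ⋃ D : Matrix (Fin p) (Fin p) ℝ, {x | (D.IsSymm ∧
        nuclearNorm D ≤ 5 * √r * frobeniusNorm D) ∧
          ∑ i, |frobInner D (pairMat (x.1 i))| < ((n / 2 : ℕ) : ℝ) / 4 * frobeniusNorm D} := by
    ext x
    simp only [PairLowerBound, Set.mem_ofPred_eq, Set.mem_iUnion]
    push Not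
    simp only [and_assoc]
  rw [h]
  refine isOpen_iUnion fun D => ?_
  refine isOpen_const.and (isOpen_lt ?_ continuous_const)
  unfold frobInner pairMat
  simp only [Matrix.sub_apply, Matrix.vecMulVec_apply]
  fun_prop

/-- Tonelli over the noise: sections at well-behaved noise obey the fixed-noise bound, the other
sections are empty. -/
theorem measure_specNorm_gt_prod_le (hp : 1 ≤ p) (hn : 2 ≤ n) :
    ((gaussPairs (n / 2) p).prod (gaussVec n))
      {x | ((∀ i, |x.2 i| ≤ 2 * √(Real.log n)) ∧ ∑ i, x.2 i ^ 2 ≤ 3 / 2 * n) ∧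
        tuning n p 1 < specNorm (∑ i, pairDiff x.2 i • pairMat (x.1 i))} ≤
      ENNReal.ofReal (2 * Real.exp (-(p / 10))) := by
  have hmeas : MeasurableSet {x : (Fin (n / 2) → (Fin p → ℝ) × (Fin p → ℝ)) × (Fin n → ℝ) |
      ((∀ i, |x.2 i| ≤ 2 * √(Real.log n)) ∧ ∑ i, x.2 i ^ 2 ≤ 3 / 2 * n) ∧
        tuning n p 1 < specNorm (∑ i, pairDiff x.2 i • pairMat (x.1 i))} := by
    have h : ∀ i, IsClosed {x : (Fin (n / 2) → (Fin p → ℝ) × (Fin p → ℝ)) × (Fin n → ℝ) |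
        |x.2 i| ≤ 2 * √(Real.log n)} := fun i => isClosed_le (by fun_prop) continuous_const
    have h' : IsClosed {x : (Fin (n / 2) → (Fin p → ℝ) × (Fin p → ℝ)) × (Fin n → ℝ) |
        ∑ i, x.2 i ^ 2 ≤ 3 / 2 * n} := isClosed_le (by fun_prop) continuous_const
    have := ((isClosed_iInter h).inter h').measurableSet.inter
      (isOpen_lt continuous_const (continuous_specNorm_sum_pairMat (n := n) (p := p))
        (f := fun _ => tuning n p 1)).measurableSet
    convert this using 1
    ext x
    simp
  rw [Measure.prod_apply_symm hmeas]
  calc _ ≤ ∫⁻ _, ENNReal.ofReal (2 * Real.exp (-(p / 10))) ∂gaussVec n := by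
        refine lintegral_mono fun ζ => ?_
        by_cases hζ : (∀ i, |ζ i| ≤ 2 * √(Real.log n)) ∧ ∑ i, ζ i ^ 2 ≤ 3 / 2 * n
        · refine (measure_mono fun b hb => ?_).trans (measure_specNorm_gt_le hp hn hζ.1 hζ.2)
          exact hb.2
        · refine (measure_mono_null (fun b hb => ?_) (measure_empty (μ := gaussPairs (n / 2) p))
            ).trans_le zero_le
          exact hζ hb.1
    _ = _ := by simp

theorem exceptionalSet_one_subset (n p r : ℕ) : exceptionalSet n p r 1 ⊆
    ((Set.univ ×ˢ {ζ | (n : ℝ) < ∑ i, |ζ i|} ∪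
      Set.univ ×ˢ {ζ | ∃ i, 2 * √(Real.log n) < |ζ i|}) ∪
      (Set.univ ×ˢ {ζ | 3 / 2 * (n : ℝ) < ∑ i, ζ i ^ 2} ∪
      {x | ((∀ i, |x.2 i| ≤ 2 * √(Real.log n)) ∧ ∑ i, x.2 i ^ 2 ≤ 3 / 2 * n) ∧
        tuning n p 1 < specNorm (∑ i, pairDiff x.2 i • pairMat (x.1 i))})) ∪
      {b | ¬PairLowerBound r b} ×ˢ Set.univ := by
  rintro x ((hx | hx) | hx)
  · refine Or.inl (Or.inl (Or.inl ⟨trivial, ?_⟩))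
    simpa using hx
  · by_cases h1 : ∃ i, 2 * √(Real.log n) < |x.2 i|
    · exact Or.inl (Or.inl (Or.inr ⟨trivial, h1⟩))
    · by_cases h2 : 3 / 2 * (n : ℝ) < ∑ i, x.2 i ^ 2
      · exact Or.inl (Or.inr (Or.inl ⟨trivial, h2⟩))
      · push Not at h1
        exact Or.inl (Or.inr (Or.inr ⟨⟨h1, not_lt.1 h2⟩, hx⟩))
  · exact Or.inr ⟨hx, trivial⟩

/-- A union bound: `9/n` and `2/n` from the size of the noise, one `exp (-p/10)` from its squares,
two each from the dual noise and the lower bound. -/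
theorem measure_exceptionalSet_one_le (hp : 1 ≤ p) {r : ℕ} (hr : 1 ≤ r)
    (hn : (1228800 : ℝ) * r * p ≤ n) :
    ((gaussPairs (n / 2) p).prod (gaussVec n)) (exceptionalSet n p r 1) ≤
      ENNReal.ofReal (15 / n + 5 * Real.exp (-(p / 10))) := by
  have hp0 : (1 : ℝ) ≤ p := by exact_mod_cast hp
  have hr0 : (1 : ℝ) ≤ r := by exact_mod_cast hr
  have hnp : (1228800 : ℝ) * p ≤ n := by nlinarith
  have hn2 : 2 ≤ n := by
    have : (2 : ℝ) ≤ n := by linarith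
    exact_mod_cast this
  have hn0 : (0 : ℝ) < n := by linarith
  have hm : (n : ℝ) / 3 ≤ (n / 2 : ℕ) := by
    have : n ≤ 3 * (n / 2) := by omega
    have : (n : ℝ) ≤ 3 * (n / 2 : ℕ) := by exact_mod_cast this
    linarith
  have hlow : 2 * 9 ^ p * Real.exp (-(((n / 2 : ℕ) : ℝ) / (102400 * r))) ≤
      2 * Real.exp (-(p / 10)) := by
    -- This fixes `C = 1228800 = 3 · 4 · 102400`: the exponent `4p` beats the entropy `12p/5` of the
    -- net.
    have h1 : 4 * (p : ℝ) ≤ ((n / 2 : ℕ) : ℝ) / (102400 * r) := by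
      rw [le_div_iff₀ (by positivity)]
      linarith
    calc 2 * 9 ^ p * Real.exp (-(((n / 2 : ℕ) : ℝ) / (102400 * r)))
        ≤ 2 * Real.exp (12 / 5 * p) * Real.exp (-(4 * p)) := by
          gcongr
          exact nine_pow_le p
      _ ≤ _ := by
          rw [mul_assoc, ← Real.exp_add]
          gcongr
          linarith
  have hsq : Real.exp (-((n : ℝ) / 40)) ≤ Real.exp (-(p / 10)) := by
    refine Real.exp_le_exp.2 (neg_le_neg ?_)
    linarith
  refine (measure_mono (exceptionalSet_one_subset n p r)).trans ?_
  refine (measure_union_le _ _).trans ?_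
  refine (add_le_add ((measure_union_le _ _).trans (add_le_add
    (measure_union_le _ _) (measure_union_le _ _))) le_rfl).trans ?_
  simp only [Measure.prod_prod, measure_univ, one_mul, mul_one]
  refine (add_le_add (add_le_add (add_le_add (measure_sum_abs_gt_le (by omega))
    (measure_exists_abs_gt_le (by omega))) (add_le_add measure_sum_sq_gt_le
      (measure_specNorm_gt_prod_le hp hn2))) (measure_not_pairLowerBound_le hp hr)).trans ?_
  rw [← ENNReal.ofReal_add (by positivity) (by positivity),
    ← ENNReal.ofReal_add (by positivity) (by positivity),
    ← ENNReal.ofReal_add (by positivity) (by positivity),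
    ← ENNReal.ofReal_add (by positivity) (by positivity)]
  refine ENNReal.ofReal_le_ofReal ?_
  have : (9 : ℝ) / n + 2 / n ≤ 15 / n := by
    rw [← add_div]
    gcongr
    norm_num
  linarith

/-- The noise conditions are homogeneous in `σ`. Only an inclusion is claimed, which covers `σ = 0`:
there the strict inequalities become `0 < 0`. -/
theorem smul_preimage_exceptionalSet_subset {σ : ℝ} (hσ : 0 ≤ σ) (n p r : ℕ) :
    Prod.map id (fun ζ i => σ * ζ i) ⁻¹' exceptionalSet n p r σ ⊆ exceptionalSet n p r 1 := by
  rintro ⟨b, ζ⟩ ((hx | hx) | hx)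
  · refine Or.inl (Or.inl ?_)
    simp only [Prod.map_apply, id_eq, Set.mem_ofPred_eq, abs_mul, ← Finset.mul_sum, one_mul,
      abs_of_nonneg hσ] at hx ⊢
    exact lt_of_mul_lt_mul_left hx hσ
  · refine Or.inl (Or.inr ?_)
    have h1 : ∑ i, pairDiff (fun i => σ * ζ i) i • pairMat (b i) =
        σ • ∑ i, pairDiff ζ i • pairMat (b i) := by
      rw [Finset.smul_sum]
      refine Finset.sum_congr rfl fun i _ => ?_
      rw [smul_smul, pairDiff, pairDiff, mul_sub]
    have h2 : tuning n p σ = σ * tuning n p 1 := by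
      unfold tuning
      ring
    simp only [Prod.map_apply, id_eq, Set.mem_ofPred_eq] at hx ⊢
    rw [h1, h2, specNorm_smul, abs_of_nonneg hσ] at hx
    exact lt_of_mul_lt_mul_left hx hσ
  · exact Or.inr hx

end Canonical

/-! ### Transfer to an arbitrary probability space -/

section Law

theorem measurePreserving_curry {ι κ X : Type*} [Fintype ι] [Fintype κ] [MeasurableSpace X]
    (μ : Measure X) [IsProbabilityMeasure μ] :
    MeasurePreserving (fun (x : ι × κ → X) i j => x (i, j)) (Measure.pi fun _ => μ)
      (Measure.pi fun _ => Measure.pi fun _ => μ) := by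
  refine ⟨by fun_prop, ?_⟩
  have := Measure.infinitePi_map_curry (fun (_ : ι) (_ : κ) => μ)
  simp only [Measure.infinitePi_eq_pi] at this
  exact this

theorem measurePreserving_const_mul_gaussianReal (σ : ℝ≥0) :
    MeasurePreserving (fun x : ℝ => σ * x) (gaussianReal 0 1) (gaussianReal 0 (σ ^ 2)) := by
  refine ⟨by fun_prop, ?_⟩
  rw [gaussianReal_map_const_mul, mul_zero, mul_one]
  congr 1

variable {n p : ℕ} {Ω : Type*} [MeasurableSpace Ω] {P : Measure Ω}

/-- An injective reindexing of the independent scalars, followed by regrouping. For odd `n` the last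
design vector is dropped, while all `n` noise variables stay. -/
theorem hasLaw_pairs_noise {σ : ℝ≥0} {β : Fin n → Fin p → Ω → ℝ} {z : Fin n → Ω → ℝ}
    (hβ : ∀ i j, HasLaw (β i j) (gaussianReal 0 1) P)
    (hz : ∀ i, HasLaw (z i) (gaussianReal 0 (σ ^ 2)) P)
    (hind : iIndepFun (Sum.elim (fun ij : Fin n × Fin p => β ij.1 ij.2) z) P) :
    HasLaw (fun ω => ((fun i : Fin (n / 2) =>
        ((fun j => β (fstIdx i) j ω), (fun j => β (sndIdx i) j ω))), fun i => z i ω))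
      ((gaussPairs (n / 2) p).prod (Measure.pi fun _ : Fin n => gaussianReal 0 (σ ^ 2))) P := by
  let g : (Fin (n / 2) × (Fin p ⊕ Fin p)) ⊕ Fin n → (Fin n × Fin p) ⊕ Fin n :=
    Sum.map (fun x => Sum.elim (fun j => (fstIdx x.1, j)) (fun j => (sndIdx x.1, j)) x.2) id
  have hg : g.Injective := by
    refine Sum.map_injective.2 ⟨?_, Function.injective_id⟩
    rintro ⟨i, j | j⟩ ⟨i', j' | j'⟩ h <;>
      simp only [Sum.elim_inl, Sum.elim_inr, Prod.mk.injEq, fstIdx, sndIdx, Fin.mk.injEq] at h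
    · obtain ⟨h1, rfl⟩ := h
      have : i = i' := Fin.ext (by omega)
      rw [this]
    · omega
    · omega
    · obtain ⟨h1, rfl⟩ := h
      have : i = i' := Fin.ext (by omega)
      rw [this]
  let μ : (Fin (n / 2) × (Fin p ⊕ Fin p)) ⊕ Fin n → Measure ℝ :=
    Sum.elim (fun _ => gaussianReal 0 1) fun _ => gaussianReal 0 (σ ^ 2)
  have hμ : ∀ k, IsProbabilityMeasure (μ k) := by
    rintro (k | k) <;> simp only [μ, Sum.elim_inl, Sum.elim_inr] <;> infer_instance
  have hlaw : ∀ k, HasLaw (Sum.elim (fun ij : Fin n × Fin p => β ij.1 ij.2) z (g k)) (μ k) P := by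
    rintro (⟨i, j | j⟩ | i)
    · exact hβ _ _
    · exact hβ _ _
    · exact hz _
  have h1 := (hind.precomp hg).hasLaw_pi hlaw
  have h2 := (measurePreserving_sumPiEquivProdPi μ).comp_hasLaw h1
  have h3 := measurePreserving_curry (ι := Fin (n / 2)) (κ := Fin p ⊕ Fin p) (gaussianReal 0 1)
  have h4 := measurePreserving_pi (ι := Fin (n / 2)) _ _ fun _ =>
    measurePreserving_sumPiEquivProdPi (fun _ : Fin p ⊕ Fin p => gaussianReal 0 1)
  exact ((h4.comp h3).prod (MeasurePreserving.id _)).comp_hasLaw h2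

theorem measure_exceptional_le (hp : 1 ≤ p) {r : ℕ} (hr : 1 ≤ r)
    (hn : (1228800 : ℝ) * r * p ≤ n)
    {σ : ℝ≥0} {β : Fin n → Fin p → Ω → ℝ} {z : Fin n → Ω → ℝ}
    (hβ : ∀ i j, HasLaw (β i j) (gaussianReal 0 1) P)
    (hz : ∀ i, HasLaw (z i) (gaussianReal 0 (σ ^ 2)) P)
    (hind : iIndepFun (Sum.elim (fun ij : Fin n × Fin p => β ij.1 ij.2) z) P) :
    P {ω | ((fun i : Fin (n / 2) => ((fun j => β (fstIdx i) j ω), (fun j => β (sndIdx i) j ω))),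
        fun i => z i ω) ∈ exceptionalSet n p r σ} ≤
      ENNReal.ofReal (15 / n + 5 * Real.exp (-(p / 10))) := by
  have hmeas := (isOpen_exceptionalSet n p r σ).measurableSet
  have hlaw := hasLaw_pairs_noise hβ hz hind
  have hscale : MeasurePreserving
      (Prod.map id (fun ζ i => σ * ζ i) :
        (Fin (n / 2) → (Fin p → ℝ) × (Fin p → ℝ)) × (Fin n → ℝ) → _)
      ((gaussPairs (n / 2) p).prod (gaussVec n))
      ((gaussPairs (n / 2) p).prod (Measure.pi fun _ : Fin n => gaussianReal 0 (σ ^ 2))) :=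
    (MeasurePreserving.id _).prod
      (measurePreserving_pi _ _ fun _ => measurePreserving_const_mul_gaussianReal σ)
  have h1 := Measure.map_apply_of_aemeasurable hlaw.aemeasurable hmeas
  rw [hlaw.map_eq, ← hscale.measure_preimage hmeas.nullMeasurableSet] at h1
  refine h1.symm.trans_le ((measure_mono ?_).trans (measure_exceptionalSet_one_le hp hr hn))
  exact smul_preimage_exceptionalSet_subset σ.coe_nonneg n p r

end Law

/-! ### From pairs of vectors to the differenced design -/

section Link

variable {n p : ℕ}

theorem restrictedLowerBound_of_pairLowerBound {r : ℕ} {β : Fin n → Fin p → ℝ}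
    (h : PairLowerBound r fun i : Fin (n / 2) => (β (fstIdx i), β (sndIdx i))) :
    RestrictedLowerBound r β := by
  intro D hD hnuc
  refine (h D hD hnuc).trans_eq (Finset.sum_congr rfl fun i _ => ?_)
  congr 1
  rw [pairMat, diffDesign, pairDiff, design, design, ← frobInner_vecMulVec,
    ← frobInner_vecMulVec]
  simp only [frobInner, Matrix.sub_apply, mul_sub, Finset.sum_sub_distrib]

end Link

end SROP

/-! ### The main theorem -/

theorem proposition2p3 :
    ∃ C W₁ W₂ δ : ℝ, 0 < C ∧ 0 < W₁ ∧ 0 < W₂ ∧ 0 < δ ∧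
      ∀ (n p r : ℕ), 1 ≤ r → C * r * p ≤ n →
      ∀ (σ : ℝ≥0) (Ω : Type*) [MeasurableSpace Ω] (P : Measure Ω) [IsProbabilityMeasure P]
        (β : Fin n → Fin p → Ω → ℝ) (z : Fin n → Ω → ℝ),
        (∀ i j, HasLaw (β i j) (gaussianReal 0 1) P) →
        (∀ i, HasLaw (z i) (gaussianReal 0 (σ ^ 2)) P) →
        iIndepFun (Sum.elim (fun ij : Fin n × Fin p => β ij.1 ij.2) z) P →
        ∃ E : Set Ω, MeasurableSet E ∧
          1 - 15 / (n : ℝ) - 5 * Real.exp (-(p * δ)) ≤ P.real E ∧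
          ∀ ω ∈ E, ∀ A : Matrix (Fin p) (Fin p) ℝ, A.IsSymm →
            (∃ Ahat, SROP.IsEstimator σ (fun i j => β i j ω)
              (SROP.design (fun i j => β i j ω) A + fun i => z i ω) Ahat) ∧
            ∀ Ahat, SROP.IsEstimator σ (fun i j => β i j ω)
              (SROP.design (fun i j => β i j ω) A + fun i => z i ω) Ahat →
            ∀ a u v, SROP.IsSVD A a u v →
              SROP.frobeniusNorm (Ahat - A) ^ 2 ≤
                W₁ * (σ : ℝ) ^ 2 *
                    min ((r : ℝ) * p ^ 2 * Real.log n / n ^ 2 + (r : ℝ) * p / n) 1 +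
                  W₂ * (SROP.nuclearNorm (SROP.svdTail r a u v) ^ 2 / r) := by
  refine ⟨1228800, 230400 * 9216, 1, 1 / 10, by norm_num, by norm_num, by norm_num, by norm_num,
    fun n p r hr hn σ Ω _ P _ β z hβ hz hind => ?_⟩
  -- For `p = 0` the claimed probability is at most `1 - 5 < 0`, so the empty event suffices.
  rcases Nat.eq_zero_or_pos p with rfl | hp
  · refine ⟨∅, MeasurableSet.empty, ?_, fun ω hω => absurd hω (Set.notMem_empty ω)⟩
    have : 0 ≤ 15 / (n : ℝ) := by positivity
    simp
    linarith
  have hr0 : (1 : ℝ) ≤ r := by exact_mod_cast hr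
  have hp0 : (1 : ℝ) ≤ p := by exact_mod_cast hp
  have hn2 : 2 ≤ n := by
    have : (2 : ℝ) ≤ n := by nlinarith
    exact_mod_cast this
  have hn0 : (0 : ℝ) < n := by positivity
  have hbad := SROP.measure_exceptional_le hp hr hn hβ hz hind
  set B : Set Ω := {ω | ((fun i : Fin (n / 2) =>
    ((fun j => β (SROP.fstIdx i) j ω), (fun j => β (SROP.sndIdx i) j ω))),
      fun i => z i ω) ∈ SROP.exceptionalSet n p r σ} with hB
  -- The variables are only almost everywhere measurable, so `B` may fail to be measurable; a
  -- measurable hull has the same measure.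
  refine ⟨(toMeasurable P B)ᶜ, (measurableSet_toMeasurable P B).compl, ?_, fun ω hω A hA => ?_⟩
  · rw [probReal_compl_eq_one_sub (measurableSet_toMeasurable P B), Measure.real,
      measure_toMeasurable]
    have := ENNReal.toReal_le_of_le_ofReal (by positivity) hbad
    have e : (p : ℝ) * (1 / 10) = p / 10 := by ring
    rw [e]
    linarith
  · have hω' : ω ∉ B := fun h => hω (subset_toMeasurable P B h)
    simp only [hB, SROP.exceptionalSet, Set.mem_ofPred_eq, Set.mem_union, not_or, not_lt,
      not_not] at hω'
    obtain ⟨⟨h1, h2⟩, h3⟩ := hω'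
    have h1' : (∑ i, |z i ω|) / n ≤ σ := by rwa [div_le_iff₀ hn0]
    have h3' : SROP.RestrictedLowerBound r fun i j => β i j ω :=
      SROP.restrictedLowerBound_of_pairLowerBound h3
    have h2' : SROP.specNorm (SROP.diffDual (fun i j => β i j ω)
        (SROP.pairDiff fun i => z i ω)) ≤ SROP.tuning n p σ := h2
    refine ⟨SROP.exists_isEstimator ⟨A, SROP.mem_feasible_of_noise hA h1' h2'⟩,
      fun M hM a u v hsvd => ?_⟩
    have := SROP.error_bound hr hn2 σ.coe_nonneg h1' h2' h3' hA hM hsvd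
    exact this
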